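/- **Setting.** Let $I_1, I_2, \dots$ be closed real intervals $I_j=[l_j,r_j]$, $l_j\le r_j$ (repetitions allowed). For $n \ge 1$ let $G_n$ be the interval graph on $\{1,\dots,n\}$ in which $i\ne j$ are adjacent iff $I_i\cap I_j\neq\emptyset$; let $\omega_n$ be the size of a largest clique of $G_n$ and $\Delta_n$ its maximum degree. **KT-SLS** assigns to $I_i$ the color $(L(I_i),o(I_i))$ as follows. For a real $t$ let $h_t$ be the least non-negative integer that is not the level $L(I_j)$ of any interval $I_j\ni t$ with $j<i$. Then $L(I_i)=\max_{t\in I_i}h_t$, and $o(I_i)$ is the least element of $\{1,2,3\}$ different from $o(I_j)$ for all $j<i$ with $I_j\cap I_i\ne\emptyset$ and $L(I_j)=L(I_i)$. **handle-Insert** keeps: a balanced interval tree of all inserted intervals; a balanced interval tree $\mathcal E$ of all distinct endpoints; a table $T$ of interval trees, $T[h]$ holding the intervals of level $h$; the level and offset of each interval; and, for each endpoint $t\in\mathcal E$, a dynamic array $A_t$ of bits ($A_t[l]=1$ iff some interval of level $l$ contains $t$) together with a doubly linked list $Q_t$ of the indices $l$ with $A_t[l]=0$ in increasing order, whose nodes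 are accessible by index. The height stored at $t$ is the head of $Q_t$, or the length of $A_t$ if $Q_t$ is empty. To insert $I_i=[l_i,r_i]$ it inserts $I_i$ into the interval tree; for each of $l_i,r_i$ not yet in $\mathcal E$ it builds $A_t,Q_t$ from the levels of the earlier intervals containing that point (found by an intersection query) and inserts the point into $\mathcal E$; it queries $S=\mathcal E\cap I_i$ and sets $L(I_i)$ to the maximum stored height over $S$; for every $t\in S$ it extends $A_t$ and $Q_t$ beyond index $L(I_i)$ if necessary, sets $A_t[L(I_i)]=1$ and deletes $L(I_i)$ from $Q_t$; finally it queries $T[L(I_i)]$ for the intervals meeting $I_i$, sets $o(I_i)$ to the least offset in $\{1,2,3\}$ not used by them, and inserts $I_i$ into $T[L(I_i)]$. Time is the number of elementary steps (comparisons of endpoints, arithmetic on indices, pointer and array accesses; the reallocation of a full dynamic array to about twice its capacity costs the number of cells allocated and copied). **Theorem.** There is an absolute constant $C>0$ such that for every sequence $I_1,I_2,\dots$ of intervals, inserted one by one by handle-Insert into the initially empty data structure: 1. for every $n\ge2$, the first $n$ insertions take total time at most $n\cdot C(\log n+\Delta_n)$, i.e. the amortized time per insertion is $O(\log n+\Delta_n)$;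 2. for every $n$, after $n$ insertions the color stored for each $I_i$, $i\le n$, is the color $(L(I_i),o(I_i))$ defined by KT-SLS (in particular that color is well defined, and it never changes); 3. for every $n\ge1$, after $n$ insertions the stored colors form a proper coloring of $G_n$ that uses at most $3\omega_n-2$ distinct colors. -/

import Mathlib

/-!
Incremental colouring of intervals.

The first part fixes the cost model.  A program is a value of `Timed β`: a result together with the
number of elementary steps spent on it.  Elementary steps, each of cost one, are: comparing two
endpoints, arithmetic and comparison on natural numbers (levels, sizes, indices), following a
pointer, allocating or overwriting a record of constant size, reading or writing one cell of an
array.  Programs are assembled from `op` (one elementary step) by sequencing, branching on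
a computed boolean or pointer, and recursion; each recursive call executes at least one `op`.
The only step of non-constant cost is the reallocation of a full dynamic array, which is charged
for the cells it allocates and the cells it copies.
-/

namespace IntervalColoring

/-! ### Cost model -/

/-- A result together with the number of elementary steps that were used to compute it. -/
structure Timed (β : Type) where
  val : β
  time : ℕ

namespace Timed

instance : Monad Timed where
  pure x := ⟨x, 0⟩
  bind x f := ⟨(f x.val).val, x.time + (f x.val).time⟩

end Timed

/-- One elementary step with result `x`. -/
def op {β : Type} (x : β) : Timed β := ⟨x, 1⟩

/-- `k` elementary steps. -/
def charge (k : ℕ) : Timed Unit := ⟨(), k⟩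

/-! ### Dynamic arrays -/

/-- A dynamic array: a block of `cap` cells, of which the first `elems.size` are in use. -/
structure DynArray (β : Type) where
  elems : Array β
  cap : ℕ

namespace DynArray

variable {β : Type}

def empty : DynArray β := ⟨#[], 0⟩

def size (a : DynArray β) : Timed ℕ := op a.elems.size

/-- Read cell `i`; `none` if the index is out of range. -/
def get (a : DynArray β) (i : ℕ) : Timed (Option β) := op a.elems[i]?

/-- Overwrite cell `i` in place. -/
def set (a : DynArray β) (i : ℕ) (x : β) : Timed (DynArray β) :=
  op ⟨a.elems.setIfInBounds i x, a.cap⟩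

/-- Append a cell.  A full block is replaced by a block of (about) twice the capacity: all cells of
the new block are allocated and all cells in use are copied. -/
def push (a : DynArray β) (x : β) : Timed (DynArray β) := do
  let full ← op (decide (a.cap ≤ a.elems.size))
  if full then
    let c ← op (2 * a.cap + 1)
    charge (c + a.elems.size)
    op ⟨a.elems.push x, c⟩
  else
    op ⟨a.elems.push x, a.cap⟩

end DynArray

/-! ### Interval trees

Balanced (AVL) search trees on the left endpoints, in which every node also stores the largest
right endpoint that occurs in its subtree. -/

/-- A node stores the height of its subtree, the largest right endpoint in its subtree, the left
subtree, the interval `[lo, hi]`, the identifier of that interval, and the right subtree. -/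
inductive ITree (α : Type) where
  | leaf : ITree α
  | node (ht : ℕ) (mx : α) (l : ITree α) (lo hi : α) (id : ℕ) (r : ITree α) : ITree α

namespace ITree

variable {α : Type} [LinearOrder α]

def height : ITree α → Timed ℕ
  | leaf => op 0
  | node ht _ _ _ _ _ _ => op ht

/-- The maximum of `b` and of all right endpoints stored in the tree. -/
def maxWith (b : α) : ITree α → Timed α
  | leaf => op b
  | node _ mx _ _ _ _ _ => op (max mx b)

/-- Allocate a node with given children and compute its two derived fields. -/
def mk (l : ITree α) (lo hi : α) (id : ℕ) (r : ITree α) : Timed (ITree α) := do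
  let hl ← l.height
  let hr ← r.height
  let h ← op (max hl hr)
  let h1 ← op (h + 1)
  let m ← l.maxWith hi
  let mx ← r.maxWith m
  op (node h1 mx l lo hi id r)

/-- Single or double rotation for a left subtree that is too high. -/
def rotateRight (l : ITree α) (lo hi : α) (id : ℕ) (r : ITree α) : Timed (ITree α) :=
  match l with
  | leaf => mk l lo hi id r
  | node _ _ ll llo lhi lid lr => do
      let hll ← ll.height
      let hlr ← lr.height
      let outer ← op (decide (hlr ≤ hll))
      if outer then
        let r1 ← mk lr lo hi id r
        mk ll llo lhi lid r1
      else
        match lr with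
        | leaf => mk l lo hi id r
        | node _ _ ml mlo mhi mid mr => do
            let l1 ← mk ll llo lhi lid ml
            let r1 ← mk mr lo hi id r
            mk l1 mlo mhi mid r1

/-- Single or double rotation for a right subtree that is too high. -/
def rotateLeft (l : ITree α) (lo hi : α) (id : ℕ) (r : ITree α) : Timed (ITree α) :=
  match r with
  | leaf => mk l lo hi id r
  | node _ _ rl rlo rhi rid rr => do
      let hrl ← rl.height
      let hrr ← rr.height
      let outer ← op (decide (hrl ≤ hrr))
      if outer then
        let l1 ← mk l lo hi id rl
        mk l1 rlo rhi rid rr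
      else
        match rl with
        | leaf => mk l lo hi id r
        | node _ _ ml mlo mhi mid mr => do
            let l1 ← mk l lo hi id ml
            let r1 ← mk mr rlo rhi rid rr
            mk l1 mlo mhi mid r1

/-- A node with the given children, rebalanced if the heights differ by more than one. -/
def balance (l : ITree α) (lo hi : α) (id : ℕ) (r : ITree α) : Timed (ITree α) := do
  let hl ← l.height
  let hr ← r.height
  let leftHeavy ← op (decide (hr + 1 < hl))
  if leftHeavy then
    rotateRight l lo hi id r
  else
    let rightHeavy ← op (decide (hl + 1 < hr))
    if rightHeavy then
      rotateLeft l lo hi id r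
    else
      mk l lo hi id r

/-- Insert the interval `[x, y]` with identifier `k`. -/
def insert (x y : α) (k : ℕ) : ITree α → Timed (ITree α)
  | leaf => mk leaf x y k leaf
  | node _ _ l lo hi id r => do
      let goLeft ← op (decide (x < lo))
      if goLeft then
        let l1 ← insert x y k l
        balance l1 lo hi id r
      else
        let r1 ← insert x y k r
        balance l lo hi id r1

/-- Put the identifiers of all stored intervals that intersect `[x, y]` in front of `acc`. -/
def query (x y : α) : ITree α → List ℕ → Timed (List ℕ)
  | leaf, acc => op acc
  | node _ mx l lo hi id r, acc => do
      let allBefore ← op (decide (mx < x))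
      if allBefore then
        pure acc
      else
        let rightAfter ← op (decide (y < lo))
        if rightAfter then
          query x y l acc
        else
          let acc1 ← query x y r acc
          let hit ← op (decide (x ≤ hi))
          if hit then
            let acc2 ← op (id :: acc1)
            query x y l acc2
          else
            query x y l acc1

/-- The list of identifiers of all stored intervals that intersect `[x, y]`. -/
def intersection (t : ITree α) (x y : α) : Timed (List ℕ) := query x y t []

end ITree

/-! ### Supporting line segments

The supporting line segment at an endpoint `t` is kept as a dynamic array `A` of flags (`A[l]` tells
whether an interval of level `l` contains `t`), and a doubly linked list `Q` of all indices `l` with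
`A[l] = false`, in increasing order.  The list node that holds `l` lives in the cell `ptr[l]` of
a second dynamic array (`none` if `l` is not in the list), so that links are indices. -/

/-- The links of a node of the doubly linked list. -/
structure Link where
  prev : Option ℕ
  next : Option ℕ

structure SLS where
  A : DynArray Bool
  ptr : DynArray (Option Link)
  head : Option ℕ
  tail : Option ℕ

namespace SLS

def empty : SLS := ⟨DynArray.empty, DynArray.empty, none, none⟩

/-- Overwrite the `next` link of node `i`, or the head of the list if there is no such node. -/
def setNext (s : SLS) (i v : Option ℕ) : Timed SLS :=
  match i with
  | none => op { s with head := v }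
  | some p => do
      let c ← s.ptr.get p
      match c with
      | some (some k) => do
          let a ← s.ptr.set p (some { k with next := v })
          op { s with ptr := a }
      | _ => pure s

/-- Overwrite the `prev` link of node `i`, or the tail of the list if there is no such node. -/
def setPrev (s : SLS) (i v : Option ℕ) : Timed SLS :=
  match i with
  | none => op { s with tail := v }
  | some p => do
      let c ← s.ptr.get p
      match c with
      | some (some k) => do
          let a ← s.ptr.set p (some { k with prev := v })
          op { s with ptr := a }
      | _ => pure s

/-- Extend `A` by one cell with value `false` and insert its index at the end of `Q`. -/
def grow (s : SLS) : Timed SLS := do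
  let i ← s.A.size
  let a ← s.A.push false
  let p ← s.ptr.push (some ⟨s.tail, none⟩)
  let s1 ← op { s with A := a, ptr := p }
  let s2 ← s1.setNext s.tail (some i)
  op { s2 with tail := some i }

/-- `k`-fold `grow`. -/
def growBy : ℕ → SLS → Timed SLS
  | 0, s => op s
  | k + 1, s => do
      let s1 ← s.grow
      growBy k s1

/-- Delete `l` from `Q`; nothing happens if `l` is not in `Q`. -/
def unlink (s : SLS) (l : ℕ) : Timed SLS := do
  let c ← s.ptr.get l
  match c with
  | some (some k) => do
      let s1 ← s.setNext k.prev k.next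
      let s2 ← s1.setPrev k.next k.prev
      let p ← s2.ptr.set l none
      op { s2 with ptr := p }
  | _ => pure s

/-- Set `A[l]` to `true` and delete `l` from `Q`. -/
def mark (s : SLS) (l : ℕ) : Timed SLS := do
  let a ← s.A.set l true
  let s1 ← op { s with A := a }
  s1.unlink l

/-- `mark` for all entries of a list. -/
def markAll : List ℕ → SLS → Timed SLS
  | [], s => op s
  | l :: ls, s => do
      let s1 ← s.mark l
      markAll ls s1

/-- The height of the supporting line segment: the first entry of `Q`, or the length of `A` if `Q`
is empty (then all flags are set). -/
def height (s : SLS) : Timed ℕ := do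
  let h ← op s.head
  match h with
  | some v => pure v
  | none => s.A.size

end SLS

/-! ### The algorithm -/

/-- Colour of an interval, as far as it has been computed. -/
structure ColorRec where
  level : Option ℕ
  offset : Option ℕ

/-- The data kept between two insertions.  Intervals are identified by their index in the sequence,
endpoints by their index in the array `sls`. -/
structure State (α : Type) where
  /-- interval tree of all intervals -/
  ivals : ITree α
  /-- interval tree of all endpoints, each endpoint `t` being stored as `[t, t]` -/
  ends : ITree α
  /-- table that maps a level to the interval tree of all intervals of that level -/
  table : DynArray (ITree α)
  /-- level and offset of every interval -/
  colors : DynArray ColorRec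
  /-- supporting line segment of every endpoint -/
  sls : DynArray SLS

namespace State

variable {α : Type} [LinearOrder α]

def init : State α := ⟨.leaf, .leaf, .empty, .empty, .empty⟩

/-- Go through a list of intervals; compute the maximum of `h` and of the levels of these intervals,
and put these levels in front of `U`.  An interval whose level is not yet known is skipped. -/
def collectLevels (colors : DynArray ColorRec) :
    List ℕ → ℕ → List ℕ → Timed (ℕ × List ℕ)
  | [], h, U => op (h, U)
  | i :: is, h, U => do
      let c ← colors.get i
      match c with
      | some ⟨some l, _⟩ => do
          let h1 ← op (max h l)
          let U1 ← op (l :: U)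
          collectLevels colors is h1 U1
      | _ => collectLevels colors is h U

/-- The procedure compute-SLS. -/
def computeSLS (s : State α) (t : α) : Timed SLS := do
  let It ← s.ivals.intersection t t
  let hU ← collectLevels s.colors It 0 []
  let k ← op (hU.1 + 1)
  let e ← SLS.growBy k SLS.empty
  SLS.markAll hU.2 e

/-- Make sure that `t` is stored as an endpoint, with its supporting line segment. -/
def addEndpoint (s : State α) (t : α) : Timed (State α) := do
  let found ← s.ends.intersection t t
  let new ← op found.isEmpty
  if new then
    let e ← s.computeSLS t
    let k ← s.sls.size
    let a ← s.sls.push e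
    let tr ← s.ends.insert t t k
    op { s with sls := a, ends := tr }
  else
    pure s

/-- The maximum of `h` and of the heights of the listed supporting line segments. -/
def maxHeight (sls : DynArray SLS) : List ℕ → ℕ → Timed ℕ
  | [], h => op h
  | k :: ks, h => do
      let c ← sls.get k
      match c with
      | some e => do
          let ht ← e.height
          let h1 ← op (max h ht)
          maxHeight sls ks h1
      | none => maxHeight sls ks h

/-- The procedure compute-max-SLS: the endpoints in `[x, y]` and the maximum height there. -/
def computeMaxSLS (s : State α) (x y : α) : Timed (List ℕ × ℕ) := do
  let S ← s.ends.intersection x y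
  let h ← maxHeight s.sls S 0
  op (S, h)

/-- The procedure update-Endpoints: record an interval of level `l` at all listed endpoints. -/
def updateEndpoints (l : ℕ) : List ℕ → DynArray SLS → Timed (DynArray SLS)
  | [], sls => op sls
  | k :: ks, sls => do
      let c ← sls.get k
      match c with
      | some e => do
          let sz ← e.A.size
          let m ← op (l + 1 - sz)
          let e1 ← e.growBy m
          let e2 ← e1.mark l
          let sls1 ← sls.set k e2
          updateEndpoints l ks sls1
      | none => updateEndpoints l ks sls

/-- Append `k` empty interval trees to the table. -/
def growTable : ℕ → DynArray (ITree α) → Timed (DynArray (ITree α))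
  | 0, T => op T
  | k + 1, T => do
      let T1 ← T.push .leaf
      growTable k T1

/-- Go through a list of intervals and find out which of the offsets 1 and 2 are in use. -/
def usedOffsets (colors : DynArray ColorRec) :
    List ℕ → Bool → Bool → Timed (Bool × Bool)
  | [], u1, u2 => op (u1, u2)
  | i :: is, u1, u2 => do
      let c ← colors.get i
      match c with
      | some ⟨_, some o⟩ => do
          let b1 ← op (u1 || o == 1)
          let b2 ← op (u2 || o == 2)
          usedOffsets colors is b1 b2
      | _ => usedOffsets colors is u1 u2

/-- The procedure compute-Offset, for the interval `[x, y]` with index `i` and level `l`. -/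
def computeOffset (s : State α) (x y : α) (i l : ℕ) : Timed (State α) := do
  let sz ← s.table.size
  let m ← op (l + 1 - sz)
  let T ← growTable m s.table
  let c ← T.get l
  match c with
  | some tr => do
      let S ← tr.intersection x y
      let u ← usedOffsets s.colors S false false
      let o ← op (if u.1 then (if u.2 then 3 else 2) else 1)
      let cs ← s.colors.set i ⟨some l, some o⟩
      let tr1 ← tr.insert x y i
      let T1 ← T.set l tr1
      op { s with table := T1, colors := cs }
  | none => pure s

/-- The procedure handle-Insert. -/
def handleInsert (s : State α) (J : NonemptyInterval α) : Timed (State α) := do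
  let i ← s.colors.size
  let tr ← s.ivals.insert J.fst J.snd i
  let cs ← s.colors.push ⟨none, none⟩
  let s1 ← op { s with ivals := tr, colors := cs }
  let s2 ← s1.addEndpoint J.fst
  let s3 ← s2.addEndpoint J.snd
  let Sh ← s3.computeMaxSLS J.fst J.snd
  let cs1 ← s3.colors.set i ⟨some Sh.2, none⟩
  let a ← updateEndpoints Sh.2 Sh.1 s3.sls
  let s4 ← op { s3 with colors := cs1, sls := a }
  s4.computeOffset J.fst J.snd i Sh.2

/-- The colour (level, offset) that the data structure stores for the interval with index `i`. -/
def color (s : State α) (i : ℕ) : Option (ℕ × ℕ) :=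
  match s.colors.elems[i]? with
  | some ⟨some l, some o⟩ => some (l, o)
  | _ => none

end State

/-- Insert the first `n` intervals of the sequence `I`, in order, into the empty data structure. -/
def run {α : Type} [LinearOrder α] (I : ℕ → NonemptyInterval α) : ℕ → Timed (State α)
  | 0 => pure State.init
  | n + 1 => do
      let s ← run I n
      s.handleInsert (I n)

/-! ### Interval graphs and the abstract algorithm KT-SLS -/

/-- Two intervals have a common point. -/
def Meets {α : Type} [LinearOrder α] (J K : NonemptyInterval α) : Prop := ∃ t, t ∈ J ∧ t ∈ K

/-- The interval graph of the first `n` intervals of a sequence. -/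
def intervalGraph {α : Type} [LinearOrder α] (I : ℕ → NonemptyInterval α) (n : ℕ) :
    SimpleGraph (Fin n) where
  Adj i j := i ≠ j ∧ Meets (I i) (I j)
  symm := ⟨fun _ _ h => ⟨h.1.symm, h.2.imp fun _ ht => ht.symm⟩⟩
  loopless := ⟨fun _ h => h.1 rfl⟩

open Classical in
/-- The maximum degree of the interval graph of the first `n` intervals. -/
noncomputable def maxDeg {α : Type} [LinearOrder α] (I : ℕ → NonemptyInterval α) (n : ℕ) : ℕ :=
  (intervalGraph I n).maxDegree

/-- The height at `t` of the supporting line segment when the first `i` intervals are present: the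
least natural number that is not the level of one of these intervals containing `t`. -/
noncomputable def slsHeight {α : Type} [LinearOrder α] (I : ℕ → NonemptyInterval α) (L : ℕ → ℕ)
    (i : ℕ) (t : α) : ℕ :=
  sInf {y : ℕ | ∀ j < i, t ∈ I j → L j ≠ y}

/-- `L` and `o` are the levels and offsets that algorithm KT-SLS computes for the sequence `I`. -/
structure IsKTSLS {α : Type} [LinearOrder α] (I : ℕ → NonemptyInterval α) (L o : ℕ → ℕ) :
    Prop where
  level : ∀ i, IsGreatest {h | ∃ t ∈ I i, h = slsHeight I L i t} (L i)
  offset : ∀ i, IsLeast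
    (({1, 2, 3} : Set ℕ) \ {c | ∃ j < i, Meets (I j) (I i) ∧ L j = L i ∧ o j = c}) (o i)

end IntervalColoring

/-!
Any two intervals of the same level that meet are told apart by a private point of each: the point
where the level of an interval is attained lies in no other interval of that level. Hence an
interval meets at most two others of its level, one on either side, and three offsets suffice; the
offset is always `1` on level `0`, and levels are less than the clique number.

The maximal height in `I n` is attained at a left endpoint, because moving a point of `I n` to the
left up to the next left endpoint leaves none of the intervals that contain it. This is why it
suffices to keep supporting line segments at endpoints.

For the running time, an insertion performs boundedly many operations on balanced trees and visits
`O(Δ + 1)` intervals and endpoints. Reallocations and extensions of supporting line segments are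
paid for by a potential, which at the end is at most linear in `n (Δ + 1)`.
-/

namespace IntervalColoring

namespace Timed

variable {β γ : Type}

@[simp] theorem val_bind (x : Timed β) (f : β → Timed γ) : (x >>= f).val = (f x.val).val := rfl

@[simp] theorem time_bind (x : Timed β) (f : β → Timed γ) :
    (x >>= f).time = x.time + (f x.val).time := rfl

@[simp] theorem val_pure (x : β) : (pure x : Timed β).val = x := rfl

@[simp] theorem time_pure (x : β) : (pure x : Timed β).time = 0 := rfl

@[simp] theorem val_op (x : β) : (op x).val = x := rfl

@[simp] theorem time_op (x : β) : (op x).time = 1 := rfl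

@[simp] theorem time_charge (k : ℕ) : (charge k).time = k := rfl

@[simp] theorem val_ite (p : Prop) [Decidable p] (x y : Timed β) :
    (if p then x else y).val = if p then x.val else y.val := apply_ite val p x y

@[simp] theorem time_ite (p : Prop) [Decidable p] (x y : Timed β) :
    (if p then x else y).time = if p then x.time else y.time := apply_ite time p x y

end Timed

/-! ### Balanced trees -/

namespace ITree

/-- An interval `[lo, hi]` with its identifier, as it is stored in a node of an interval tree. -/
structure Entry (α : Type) where
  lo : α
  hi : α
  id : ℕ

variable {α : Type}

/-- The entries of an interval tree in symmetric order. -/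
def entries : ITree α → List (Entry α)
  | leaf => []
  | node _ _ l lo hi id r => l.entries ++ ⟨lo, hi, id⟩ :: r.entries

/-- The height recorded in the root. -/
def ht : ITree α → ℕ
  | leaf => 0
  | node h _ _ _ _ _ _ => h

@[simp] theorem ht_leaf : (leaf : ITree α).ht = 0 := rfl

@[simp] theorem ht_node (h : ℕ) (m : α) (l : ITree α) (lo hi : α) (id : ℕ) (r : ITree α) :
    (node h m l lo hi id r).ht = h := rfl

@[simp] theorem val_height (t : ITree α) : t.height.val = t.ht := by cases t <;> rfl

@[simp] theorem time_height (t : ITree α) : t.height.time = 1 := by cases t <;> rfl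

/-- The AVL condition: recorded heights are correct, and those of siblings differ by at most one. -/
def Balanced : ITree α → Prop
  | leaf => True
  | node h _ l _ _ _ r =>
      h = max l.ht r.ht + 1 ∧ l.ht ≤ r.ht + 1 ∧ r.ht ≤ l.ht + 1 ∧ l.Balanced ∧ r.Balanced

/-- The entries are sorted by left endpoint. -/
def Sorted [LE α] (t : ITree α) : Prop := t.entries.Pairwise fun e f => e.lo ≤ f.lo

/-- Every node records the largest right endpoint in its subtree. The maximum is described by its
strict upper bounds, which is how queries use it. -/
def Augmented [LT α] : ITree α → Prop
  | leaf => True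
  | node _ m l lo hi id r =>
      (∀ x, m < x ↔ ∀ e ∈ (l.entries ++ ⟨lo, hi, id⟩ :: r.entries : List (Entry α)), e.hi < x) ∧
        l.Augmented ∧ r.Augmented

theorem Balanced.two_pow_le_length_entries_add_one {t : ITree α} (ht : t.Balanced) {k : ℕ}
    (hk : 2 * k ≤ t.ht) : 2 ^ k ≤ t.entries.length + 1 := by
  induction k generalizing t with
  | zero => simp
  | succ k ih =>
    cases t with
    | leaf => simp at hk
    | node h m l lo hi id r =>
      obtain ⟨hh, hlr, hrl, hl, hr⟩ := ht
      rw [ht_node] at hk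
      have hl2 := ih hl (by omega)
      have hr2 := ih hr (by omega)
      simp only [entries, List.length_append, List.length_cons, pow_succ]
      omega

theorem Balanced.ht_le {t : ITree α} (ht : t.Balanced) {M : ℕ} (hM : t.entries.length ≤ M) :
    t.ht ≤ 2 * Nat.log 2 (M + 1) + 1 := by
  have hpow := ht.two_pow_le_length_entries_add_one (k := t.ht / 2) (by omega)
  have hlog := Nat.le_log_of_pow_le one_lt_two (hpow.trans (Nat.add_le_add_right hM 1))
  omega

variable [LinearOrder α]

@[simp] theorem time_maxWith (b : α) (t : ITree α) : (t.maxWith b).time = 1 := by cases t <;> rfl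

theorem Augmented.maxWith_lt_iff {t : ITree α} (ht : t.Augmented) {b x : α} :
    (t.maxWith b).val < x ↔ b < x ∧ ∀ e ∈ t.entries, e.hi < x := by
  cases t with
  | leaf => simp [maxWith, entries]
  | node h m l lo hi id r => simp only [maxWith, Timed.val_op, max_lt_iff, ht.1, entries, and_comm]

section Balance

variable (l : ITree α) (lo hi : α) (id : ℕ) (r : ITree α)

@[simp] theorem time_mk : (mk l lo hi id r).time = 7 := by simp [mk]

@[simp] theorem ht_mk : (mk l lo hi id r).val.ht = max l.ht r.ht + 1 := by simp [mk]

@[simp] theorem entries_mk :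
    (mk l lo hi id r).val.entries = l.entries ++ ⟨lo, hi, id⟩ :: r.entries := by
  simp [mk, entries]

theorem time_rotateRight_le : (rotateRight l lo hi id r).time ≤ 24 := by
  unfold rotateRight
  split
  · simp
  · simp only [Timed.time_bind, time_height, val_height, Timed.time_op, Timed.val_op,
      decide_eq_true_eq]
    split
    · simp
    · split <;> simp

theorem time_rotateLeft_le : (rotateLeft l lo hi id r).time ≤ 24 := by
  unfold rotateLeft
  split
  · simp
  · simp only [Timed.time_bind, time_height, val_height, Timed.time_op, Timed.val_op,
      decide_eq_true_eq]
    split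
    · simp
    · split <;> simp

theorem time_balance_le : (balance l lo hi id r).time ≤ 28 := by
  have hright := time_rotateRight_le l lo hi id r
  have hleft := time_rotateLeft_le l lo hi id r
  simp only [balance, Timed.time_bind, time_height, val_height, Timed.time_op, Timed.val_op,
    decide_eq_true_eq]
  split
  · omega
  · simp only [Timed.time_bind, Timed.val_op, Timed.time_op, decide_eq_true_eq]
    split
    · omega
    · simp

theorem val_balance :
    (balance l lo hi id r).val =
      if r.ht + 1 < l.ht then (rotateRight l lo hi id r).val
      else if l.ht + 1 < r.ht then (rotateLeft l lo hi id r).val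
      else (mk l lo hi id r).val := by
  simp only [balance, Timed.val_bind, val_height, Timed.val_op, decide_eq_true_eq, Timed.val_ite]

@[simp] theorem entries_rotateRight :
    (rotateRight l lo hi id r).val.entries = l.entries ++ ⟨lo, hi, id⟩ :: r.entries := by
  unfold rotateRight
  split
  · simp
  · simp only [Timed.val_bind, val_height, Timed.val_op, decide_eq_true_eq]
    split
    · simp [entries]
    · split <;> simp [entries]

@[simp] theorem entries_rotateLeft :
    (rotateLeft l lo hi id r).val.entries = l.entries ++ ⟨lo, hi, id⟩ :: r.entries := by
  unfold rotateLeft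
  split
  · simp
  · simp only [Timed.val_bind, val_height, Timed.val_op, decide_eq_true_eq]
    split
    · simp [entries]
    · split <;> simp [entries]

@[simp] theorem entries_balance :
    (balance l lo hi id r).val.entries = l.entries ++ ⟨lo, hi, id⟩ :: r.entries := by
  rw [val_balance]
  split_ifs <;> simp

end Balance

section Invariants

variable {l r : ITree α} {lo hi : α} {id : ℕ}

theorem Augmented.mk (hl : l.Augmented) (hr : r.Augmented) :
    (ITree.mk l lo hi id r).val.Augmented := by
  refine ⟨fun x => ?_, hl, hr⟩
  simp only [hr.maxWith_lt_iff, hl.maxWith_lt_iff, List.mem_append, List.mem_cons, or_imp,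
    forall_and, forall_eq]
  tauto

theorem Augmented.rotateRight (hl : l.Augmented) (hr : r.Augmented) :
    (ITree.rotateRight l lo hi id r).val.Augmented := by
  unfold ITree.rotateRight
  split
  · exact hl.mk hr
  · have ⟨_, hll, hlr⟩ := hl
    simp only [Timed.val_bind, val_height, Timed.val_op, decide_eq_true_eq]
    split
    · exact hll.mk (hlr.mk hr)
    · split
      · exact hl.mk hr
      · exact (hll.mk hlr.2.1).mk (hlr.2.2.mk hr)

theorem Augmented.rotateLeft (hl : l.Augmented) (hr : r.Augmented) :
    (ITree.rotateLeft l lo hi id r).val.Augmented := by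
  unfold ITree.rotateLeft
  split
  · exact hl.mk hr
  · have ⟨_, hrl, hrr⟩ := hr
    simp only [Timed.val_bind, val_height, Timed.val_op, decide_eq_true_eq]
    split
    · exact (hl.mk hrl).mk hrr
    · split
      · exact hl.mk hr
      · exact (hl.mk hrl.2.1).mk (hrl.2.2.mk hrr)

theorem Augmented.balance (hl : l.Augmented) (hr : r.Augmented) :
    (ITree.balance l lo hi id r).val.Augmented := by
  rw [val_balance]
  split_ifs
  exacts [hl.rotateRight hr, hl.rotateLeft hr, hl.mk hr]

theorem Balanced.mk (hl : l.Balanced) (hr : r.Balanced) (hlr : l.ht ≤ r.ht + 1)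
    (hrl : r.ht ≤ l.ht + 1) : (ITree.mk l lo hi id r).val.Balanced := by
  simp [ITree.mk, Balanced, *]

theorem Balanced.rotateRight (hl : l.Balanced) (hr : r.Balanced) (h : l.ht = r.ht + 2) :
    (ITree.rotateRight l lo hi id r).val.Balanced ∧
      (ITree.rotateRight l lo hi id r).val.ht ∈ Set.Icc l.ht (l.ht + 1) := by
  unfold ITree.rotateRight
  split
  · simp at h
  · obtain ⟨hh, hle, hge, hll, hlr⟩ := hl
    rw [ht_node] at h
    simp only [Timed.val_bind, val_height, Timed.val_op, decide_eq_true_eq, ht_node]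
    split_ifs with houter
    · refine ⟨hll.mk (hlr.mk hr ?_ ?_) ?_ ?_, ?_, ?_⟩ <;>
        (try simp only [Timed.val_bind, ht_mk]) <;> omega
    · split
      · simp at houter
      · obtain ⟨hh', hle', hge', hml, hmr⟩ := hlr
        simp only [ht_node] at *
        simp only [Timed.val_bind]
        refine ⟨(hll.mk hml ?_ ?_).mk (hmr.mk hr ?_ ?_) ?_ ?_, ?_, ?_⟩ <;>
          (try simp only [ht_mk]) <;> omega

theorem Balanced.rotateLeft (hl : l.Balanced) (hr : r.Balanced) (h : r.ht = l.ht + 2) :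
    (ITree.rotateLeft l lo hi id r).val.Balanced ∧
      (ITree.rotateLeft l lo hi id r).val.ht ∈ Set.Icc r.ht (r.ht + 1) := by
  unfold ITree.rotateLeft
  split
  · simp at h
  · obtain ⟨hh, hle, hge, hrl, hrr⟩ := hr
    rw [ht_node] at h
    simp only [Timed.val_bind, val_height, Timed.val_op, decide_eq_true_eq, ht_node]
    split_ifs with houter
    · refine ⟨(hl.mk hrl ?_ ?_).mk hrr ?_ ?_, ?_, ?_⟩ <;>
        (try simp only [Timed.val_bind, ht_mk]) <;> omega
    · split
      · simp at houter
      · obtain ⟨hh', hle', hge', hml, hmr⟩ := hrl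
        simp only [ht_node] at *
        simp only [Timed.val_bind]
        refine ⟨(hl.mk hml ?_ ?_).mk (hmr.mk hrr ?_ ?_) ?_ ?_, ?_, ?_⟩ <;>
          (try simp only [ht_mk]) <;> omega

theorem ht_balance_of_le (hlr : l.ht ≤ r.ht + 1) (hrl : r.ht ≤ l.ht + 1) :
    (ITree.balance l lo hi id r).val.ht = max l.ht r.ht + 1 := by
  rw [val_balance, if_neg (by omega), if_neg (by omega), ht_mk]

theorem Balanced.balance (hl : l.Balanced) (hr : r.Balanced) (hlr : l.ht ≤ r.ht + 2)
    (hrl : r.ht ≤ l.ht + 2) :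
    (ITree.balance l lo hi id r).val.Balanced ∧
      (ITree.balance l lo hi id r).val.ht ∈ Set.Icc (max l.ht r.ht) (max l.ht r.ht + 1) := by
  rw [val_balance]
  split_ifs with hleft hright
  · rw [max_eq_left (by omega)]
    exact hl.rotateRight hr (by omega)
  · rw [max_eq_right (by omega)]
    exact hl.rotateLeft hr (by omega)
  · exact ⟨hl.mk hr (by omega) (by omega), by simp⟩

end Invariants

section Insert

variable {t : ITree α} {x y : α} {k : ℕ}

theorem val_insert_node (x y : α) (k h : ℕ) (m : α) (l : ITree α) (lo hi : α) (id : ℕ)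
    (r : ITree α) :
    (insert x y k (node h m l lo hi id r)).val =
      if x < lo then (balance (insert x y k l).val lo hi id r).val
      else (balance l lo hi id (insert x y k r).val).val := by
  simp only [insert, Timed.val_bind, Timed.val_op, decide_eq_true_eq, Timed.val_ite]

theorem perm_entries_insert (t : ITree α) (x y : α) (k : ℕ) :
    (insert x y k t).val.entries.Perm (⟨x, y, k⟩ :: t.entries) := by
  induction t with
  | leaf => simp [insert, entries]
  | node h m l lo hi id r ihl ihr =>
    rw [val_insert_node]
    split_ifs
    · rw [entries_balance]
      exact ihl.append_right _
    · rw [entries_balance]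
      exact ((ihr.cons _).append_left _).trans <|
        ((List.Perm.swap _ _ _).append_left _).trans List.perm_middle

theorem Sorted.insert (ht : t.Sorted) : (ITree.insert x y k t).val.Sorted := by
  induction t with
  | leaf => simp [ITree.insert, Sorted, entries]
  | node h m l lo hi id r ihl ihr =>
    simp only [Sorted, entries, List.pairwise_append, List.pairwise_cons] at ht
    obtain ⟨hl, ⟨hlo, hr⟩, hlr⟩ := ht
    rw [val_insert_node, Sorted]
    split_ifs with hx <;> rw [entries_balance, List.pairwise_append, List.pairwise_cons]
    · refine ⟨ihl hl, ⟨hlo, hr⟩, fun e he f hf => ?_⟩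
      rcases List.mem_cons.1 ((perm_entries_insert l x y k).mem_iff.1 he) with rfl | he
      · rcases List.mem_cons.1 hf with rfl | hf
        exacts [hx.le, hx.le.trans (hlo f hf)]
      · exact hlr e he f hf
    · rw [not_lt] at hx
      have hlo' : ∀ f ∈ (ITree.insert x y k r).val.entries, lo ≤ f.lo := fun f hf => by
        rcases List.mem_cons.1 ((perm_entries_insert r x y k).mem_iff.1 hf) with rfl | hf
        exacts [hx, hlo f hf]
      refine ⟨hl, ⟨hlo', ihr hr⟩, fun e he f hf => ?_⟩
      have hle := hlr e he _ List.mem_cons_self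
      rcases List.mem_cons.1 hf with rfl | hf
      exacts [hle, hle.trans (hlo' f hf)]

theorem Augmented.insert (ht : t.Augmented) : (ITree.insert x y k t).val.Augmented := by
  induction t with
  | leaf => exact Augmented.mk (l := leaf) (r := leaf) trivial trivial
  | node h m l lo hi id r ihl ihr =>
    rw [val_insert_node]
    split_ifs
    exacts [(ihl ht.2.1).balance ht.2.2, ht.2.1.balance (ihr ht.2.2)]

theorem Balanced.insert (ht : t.Balanced) :
    (ITree.insert x y k t).val.Balanced ∧
      (ITree.insert x y k t).val.ht ∈ Set.Icc t.ht (t.ht + 1) := by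
  induction t with
  | leaf =>
    exact ⟨Balanced.mk (l := leaf) (r := leaf) trivial trivial (by simp) (by simp),
      by simp [ITree.insert]⟩
  | node h m l lo hi id r ihl ihr =>
    obtain ⟨hh, hle, hge, hl, hr⟩ := ht
    rw [val_insert_node, ht_node]
    split_ifs
    · obtain ⟨hl', hlo, hhi⟩ := ihl hl
      have hbal := hl'.balance hr (lo := lo) (hi := hi) (id := id) (by omega) (by omega)
      have heq := ht_balance_of_le (l := (ITree.insert x y k l).val) (r := r) (lo := lo)
        (hi := hi) (id := id)
      refine ⟨hbal.1, ?_, ?_⟩ <;> have := hbal.2.1 <;> have := hbal.2.2 <;> omega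
    · obtain ⟨hr', hlo, hhi⟩ := ihr hr
      have hbal := hl.balance hr' (lo := lo) (hi := hi) (id := id) (by omega) (by omega)
      have heq := ht_balance_of_le (l := l) (r := (ITree.insert x y k r).val) (lo := lo)
        (hi := hi) (id := id)
      refine ⟨hbal.1, ?_, ?_⟩ <;> have := hbal.2.1 <;> have := hbal.2.2 <;> omega

theorem Balanced.time_insert_le (ht : t.Balanced) :
    (ITree.insert x y k t).time ≤ 29 * t.ht + 7 := by
  induction t with
  | leaf => simp [ITree.insert]
  | node h m l lo hi id r ihl ihr =>
    obtain ⟨hh, -, -, hl, hr⟩ := ht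
    simp only [ITree.insert, Timed.time_bind, Timed.val_op, Timed.time_op, decide_eq_true_eq,
      ht_node]
    split_ifs
    · have hrec := ihl hl
      have hbal := time_balance_le (ITree.insert x y k l).val lo hi id r
      simp only [Timed.time_bind]
      omega
    · have hrec := ihr hr
      have hbal := time_balance_le l lo hi id (ITree.insert x y k r).val
      simp only [Timed.time_bind]
      omega

end Insert

end ITree

/-! ### Queries in balanced trees -/

namespace ITree

variable {α : Type} [LinearOrder α]

/-- The interval of the entry has a common point with `[x, y]`. -/
def Entry.Overlaps (x y : α) (e : Entry α) : Prop := e.lo ≤ y ∧ x ≤ e.hi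

instance (x y : α) : DecidablePred (Entry.Overlaps x y) :=
  fun _ => inferInstanceAs (Decidable (_ ∧ _))

/-- The identifiers of the entries that overlap `[x, y]`. -/
def hits (x y : α) (es : List (Entry α)) : List ℕ :=
  (es.filter (Entry.Overlaps x y ·)).map Entry.id

theorem hits_append (x y : α) (es fs : List (Entry α)) :
    hits x y (es ++ fs) = hits x y es ++ hits x y fs := by
  simp [hits]

theorem hits_cons (x y : α) (e : Entry α) (es : List (Entry α)) :
    hits x y (e :: es) = if e.Overlaps x y then e.id :: hits x y es else hits x y es := by
  split_ifs with h <;> simp [hits, h]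

theorem hits_eq_nil {x y : α} {es : List (Entry α)} (h : ∀ e ∈ es, ¬ e.Overlaps x y) :
    hits x y es = [] := by
  simpa [hits] using h

theorem mem_hits {x y : α} {es : List (Entry α)} {k : ℕ} :
    k ∈ hits x y es ↔ ∃ e ∈ es, e.Overlaps x y ∧ e.id = k := by
  simp [hits, and_assoc]

theorem length_hits (x y : α) (es : List (Entry α)) :
    (hits x y es).length = es.countP (Entry.Overlaps x y ·) := by
  simp [hits, List.countP_eq_length_filter]

section Node

variable (x y : α) (h : ℕ) (m : α) (l : ITree α) (lo hi : α) (id : ℕ) (r : ITree α) (acc : List ℕ)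

theorem val_query_node :
    (query x y (node h m l lo hi id r) acc).val =
      if m < x then acc
      else if y < lo then (query x y l acc).val
      else if x ≤ hi then (query x y l (id :: (query x y r acc).val)).val
      else (query x y l (query x y r acc).val).val := by
  simp only [query, Timed.val_bind, Timed.val_op, Timed.val_ite, Timed.val_pure, decide_eq_true_eq]

theorem time_query_node :
    (query x y (node h m l lo hi id r) acc).time =
      if m < x then 1
      else if y < lo then 2 + (query x y l acc).time
      else if x ≤ hi then
        4 + (query x y r acc).time + (query x y l (id :: (query x y r acc).val)).time
      else 3 + (query x y r acc).time + (query x y l (query x y r acc).val).time := by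
  simp only [query, Timed.time_bind, Timed.time_op, Timed.val_op, Timed.time_ite, Timed.time_pure,
    decide_eq_true_eq]
  split_ifs <;> omega

end Node

theorem time_query_eq_time_intersection (x y : α) (t : ITree α) (acc : List ℕ) :
    (query x y t acc).time = (t.intersection x y).time := by
  suffices h : ∀ acc acc', (query x y t acc).time = (query x y t acc').time from h acc []
  induction t with
  | leaf => intros; rfl
  | node h m l lo hi id r ihl ihr =>
    intro acc acc'
    simp only [time_query_node, ihl _ [], ihr acc acc']

theorem val_query {t : ITree α} (ht : t.Augmented) (hs : t.Sorted) (x y : α) (acc : List ℕ) :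
    (query x y t acc).val = hits x y t.entries ++ acc := by
  induction t generalizing acc with
  | leaf => simp [query, entries, hits]
  | node h m l lo hi id r ihl ihr =>
    obtain ⟨hm, hl, hr⟩ := ht
    simp only [Sorted, entries, List.pairwise_append, List.pairwise_cons] at hs
    obtain ⟨hsl, ⟨hlo, hsr⟩, -⟩ := hs
    rw [val_query_node, entries]
    split_ifs with hmx hy hx
    · rw [hits_eq_nil fun e he hov => (((hm x).1 hmx e he).trans_le hov.2).false, List.nil_append]
    · have hright : hits x y (⟨lo, hi, id⟩ :: r.entries) = [] := hits_eq_nil fun e he hov => by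
        rcases List.mem_cons.1 he with rfl | he
        exacts [(hy.trans_le hov.1).false, (hy.trans_le ((hlo e he).trans hov.1)).false]
      rw [ihl hl hsl, hits_append, hright, List.append_nil]
    · rw [ihl hl hsl, ihr hr hsr, hits_append, hits_cons, if_pos ⟨not_lt.1 hy, hx⟩,
        List.append_assoc, List.cons_append]
    · rw [ihl hl hsl, ihr hr hsr, hits_append, hits_cons, if_neg fun hov => hx hov.2,
        List.append_assoc]

theorem val_intersection {t : ITree α} (ht : t.Augmented) (hs : t.Sorted) (x y : α) :
    (t.intersection x y).val = hits x y t.entries := by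
  rw [intersection, val_query ht hs, List.append_nil]

section Time

variable {x y : α} {h : ℕ} {m : α} {l : ITree α} {lo hi : α} {id : ℕ} {r : ITree α}

theorem time_intersection_node_le :
    ((node h m l lo hi id r).intersection x y).time ≤
      4 + (l.intersection x y).time + (r.intersection x y).time := by
  rw [intersection, time_query_node]
  simp only [time_query_eq_time_intersection]
  split_ifs <;> omega

theorem time_intersection_node_le_of_lt (hy : y < lo) :
    ((node h m l lo hi id r).intersection x y).time ≤ 4 + (l.intersection x y).time := by
  rw [intersection, time_query_node, if_pos hy, time_query_eq_time_intersection]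
  split_ifs <;> omega

theorem time_intersection_le_length (t : ITree α) :
    (t.intersection x y).time ≤ 1 + 5 * t.entries.length := by
  induction t with
  | leaf => simp [intersection, query, entries]
  | node h m l lo hi id r ihl ihr =>
    have hnode := time_intersection_node_le (x := x) (y := y) (h := h) (m := m) (l := l) (lo := lo)
      (hi := hi) (id := id) (r := r)
    simp only [entries, List.length_append, List.length_cons]
    omega

theorem Augmented.time_intersection_of_forall_lt {t : ITree α} (ht : t.Augmented)
    (hx : ∀ e ∈ t.entries, e.hi < x) : (t.intersection x y).time = 1 := by
  cases t with
  | leaf => rfl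
  | node h m l lo hi id r => rw [intersection, time_query_node, if_pos ((ht.1 x).2 hx)]

theorem Balanced.time_intersection_le_countP_lo_le {t : ITree α} (hb : t.Balanced) (hs : t.Sorted) :
    (t.intersection x y).time ≤ 1 + 4 * t.ht + 5 * t.entries.countP (·.lo ≤ y) := by
  induction t with
  | leaf => simp [intersection, query, entries]
  | node h m l lo hi id r ihl ihr =>
    obtain ⟨hh, -, -, hbl, hbr⟩ := hb
    simp only [Sorted, entries, List.pairwise_append, List.pairwise_cons] at hs
    obtain ⟨hsl, ⟨-, hsr⟩, hlr⟩ := hs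
    simp only [entries, List.countP_append, List.countP_cons, ht_node]
    by_cases hy : y < lo
    · have hnode := time_intersection_node_le_of_lt (x := x) (h := h) (m := m) (l := l) (hi := hi)
        (id := id) (r := r) hy
      have hrec := ihl hbl hsl
      omega
    · have hnode := time_intersection_node_le (x := x) (y := y) (h := h) (m := m) (l := l)
        (lo := lo) (hi := hi) (id := id) (r := r)
      have hrec := ihr hbr hsr
      have hleft := time_intersection_le_length (x := x) (y := y) l
      have hall : l.entries.countP (·.lo ≤ y) = l.entries.length := List.countP_eq_length.2
        fun e he => decide_eq_true ((hlr e he _ List.mem_cons_self).trans (not_lt.1 hy))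
      rw [if_pos (decide_eq_true (not_lt.1 hy))]
      omega

/-- The entry `e` starts not after `y`, and not before some entry from `es` that reaches `x`. Up to
a constant number of root paths, these are the entries that a query for `[x, y]` visits. -/
def Near (x y : α) (es : List (Entry α)) (e : Entry α) : Prop :=
  e.lo ≤ y ∧ ∃ f ∈ es, x ≤ f.hi ∧ f.lo ≤ e.lo

instance (x y : α) (es : List (Entry α)) : DecidablePred (Near x y es) :=
  fun _ => inferInstanceAs (Decidable (_ ∧ _))

/-- If the left subtree reaches `x`, the whole right subtree is near; otherwise the left subtree
costs one step. -/
theorem Balanced.time_intersection_le_of_forall_lo_le {t : ITree α} (hb : t.Balanced)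
    (ht : t.Augmented) (hs : t.Sorted) (hy : ∀ e ∈ t.entries, e.lo ≤ y) {es : List (Entry α)}
    (hes : t.entries ⊆ es) :
    (t.intersection x y).time ≤ 1 + 5 * t.ht + 5 * t.entries.countP (Near x y es ·) := by
  induction t with
  | leaf => simp [intersection, query, entries]
  | node h m l lo hi id r ihl ihr =>
    obtain ⟨hh, -, -, hbl, hbr⟩ := hb
    obtain ⟨-, hl, hr⟩ := ht
    simp only [Sorted, entries, List.pairwise_append, List.pairwise_cons] at hs
    obtain ⟨hsl, ⟨-, hsr⟩, hlr⟩ := hs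
    simp only [entries, List.append_subset, List.cons_subset] at hes
    simp only [entries, List.mem_append, List.mem_cons, or_imp, forall_and, forall_eq] at hy
    simp only [entries, List.countP_append, List.countP_cons, ht_node]
    have hnode := time_intersection_node_le (x := x) (y := y) (h := h) (m := m) (l := l)
      (lo := lo) (hi := hi) (id := id) (r := r)
    by_cases hreach : ∃ f ∈ l.entries, x ≤ f.hi
    · obtain ⟨f, hf, hx⟩ := hreach
      have hleft := ihl hbl hl hsl hy.1 hes.1
      have hright := time_intersection_le_length (x := x) (y := y) r
      have hall : r.entries.countP (Near x y es ·) = r.entries.length :=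
        List.countP_eq_length.2 fun e he => decide_eq_true
          ⟨hy.2.2 e he, f, hes.1 hf, hx, hlr f hf e (List.mem_cons_of_mem _ he)⟩
      rw [if_pos (decide_eq_true ⟨hy.2.1, f, hes.1 hf, hx, hlr f hf _ List.mem_cons_self⟩)]
      omega
    · push Not at hreach
      have hleft := hl.time_intersection_of_forall_lt (y := y) hreach
      have hright := ihr hbr hr hsr hy.2.2 hes.2.2
      omega

theorem Balanced.time_intersection_le_countP_near {t : ITree α} (hb : t.Balanced)
    (ht : t.Augmented) (hs : t.Sorted) {es : List (Entry α)} (hes : t.entries ⊆ es) :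
    (t.intersection x y).time ≤ 1 + 9 * t.ht + 5 * t.entries.countP (Near x y es ·) := by
  induction t with
  | leaf => simp [intersection, query, entries]
  | node h m l lo hi id r ihl ihr =>
    obtain ⟨hh, -, -, hbl, hbr⟩ := hb
    obtain ⟨-, hl, hr⟩ := ht
    simp only [Sorted, entries, List.pairwise_append, List.pairwise_cons] at hs
    obtain ⟨hsl, ⟨-, hsr⟩, hlr⟩ := hs
    simp only [entries, List.append_subset, List.cons_subset] at hes
    simp only [entries, List.countP_append, List.countP_cons, ht_node]
    by_cases hy : y < lo
    · have hnode := time_intersection_node_le_of_lt (x := x) (h := h) (m := m) (l := l) (hi := hi)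
        (id := id) (r := r) hy
      have hleft := ihl hbl hl hsl hes.1
      omega
    have hnode := time_intersection_node_le (x := x) (y := y) (h := h) (m := m) (l := l)
      (lo := lo) (hi := hi) (id := id) (r := r)
    by_cases hreach : ∃ f ∈ l.entries, x ≤ f.hi
    · obtain ⟨f, hf, hx⟩ := hreach
      have hleft := hbl.time_intersection_le_of_forall_lo_le (x := x) hl hsl
        (fun e he => (hlr e he _ List.mem_cons_self).trans (not_lt.1 hy)) hes.1
      have hright := hbr.time_intersection_le_countP_lo_le (x := x) (y := y) hsr
      have hnear : r.entries.countP (·.lo ≤ y) ≤ r.entries.countP (Near x y es ·) :=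
        List.countP_mono_left fun e he hey => decide_eq_true
          ⟨of_decide_eq_true hey, f, hes.1 hf, hx, hlr f hf e (List.mem_cons_of_mem _ he)⟩
      omega
    · push Not at hreach
      have hleft := hl.time_intersection_of_forall_lt (y := y) hreach
      have hright := ihr hbr hr hsr hes.2.2
      omega

end Time

/-- A correct balanced interval tree whose entries are those of the list `es`, in some order. -/
structure Holds (t : ITree α) (es : List (Entry α)) : Prop where
  balanced : t.Balanced
  augmented : t.Augmented
  sorted : t.Sorted
  perm : t.entries.Perm es

namespace Holds

variable {t : ITree α} {es fs : List (Entry α)} {x y : α} {k : ℕ}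

theorem leaf : (leaf : ITree α).Holds [] := ⟨trivial, trivial, List.Pairwise.nil, List.Perm.nil⟩

theorem insert (h : t.Holds es) (hfs : fs.Perm (⟨x, y, k⟩ :: es)) :
    (ITree.insert x y k t).val.Holds fs :=
  ⟨h.balanced.insert.1, h.augmented.insert, h.sorted.insert,
    ((perm_entries_insert t x y k).trans (h.perm.cons _)).trans hfs.symm⟩

theorem ht_le (h : t.Holds es) {M : ℕ} (hM : es.length ≤ M) : t.ht ≤ 2 * Nat.log 2 (M + 1) + 1 :=
  h.balanced.ht_le (h.perm.length_eq ▸ hM)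

theorem mem_intersection (h : t.Holds es) :
    k ∈ (t.intersection x y).val ↔ ∃ e ∈ es, e.Overlaps x y ∧ e.id = k := by
  simp only [val_intersection h.augmented h.sorted, mem_hits, h.perm.mem_iff]

theorem length_intersection (h : t.Holds es) :
    (t.intersection x y).val.length = es.countP (Entry.Overlaps x y ·) := by
  rw [val_intersection h.augmented h.sorted, length_hits, h.perm.countP_eq]

theorem time_intersection_le (h : t.Holds es) :
    (t.intersection x y).time ≤ 1 + 9 * t.ht + 5 * es.countP (Near x y es ·) := by
  have htime := h.balanced.time_intersection_le_countP_near (x := x) (y := y) h.augmented h.sorted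
    h.perm.subset
  rwa [h.perm.countP_eq] at htime

end Holds

end ITree

/-! ### Dynamic arrays and supporting line segments -/

namespace DynArray

variable {β : Type}

/-- The invariant of dynamic arrays: the cells in use fit into the block, and the block is at most
twice as large as necessary. -/
structure WF (a : DynArray β) : Prop where
  size_le_cap : a.elems.size ≤ a.cap
  cap_le : a.cap ≤ 2 * a.elems.size

theorem WF.empty : (empty : DynArray β).WF := ⟨le_rfl, le_rfl⟩

@[simp] theorem val_size (a : DynArray β) : a.size.val = a.elems.size := rfl

@[simp] theorem time_size (a : DynArray β) : a.size.time = 1 := rfl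

@[simp] theorem val_get (a : DynArray β) (i : ℕ) : (a.get i).val = a.elems[i]? := rfl

@[simp] theorem time_get (a : DynArray β) (i : ℕ) : (a.get i).time = 1 := rfl

@[simp] theorem elems_set (a : DynArray β) (i : ℕ) (x : β) :
    (a.set i x).val.elems = a.elems.setIfInBounds i x := rfl

@[simp] theorem cap_set (a : DynArray β) (i : ℕ) (x : β) : (a.set i x).val.cap = a.cap := rfl

@[simp] theorem time_set (a : DynArray β) (i : ℕ) (x : β) : (a.set i x).time = 1 := rfl

theorem WF.set {a : DynArray β} (h : a.WF) (i : ℕ) (x : β) : (a.set i x).val.WF :=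
  ⟨by simpa using h.size_le_cap, by simpa using h.cap_le⟩

@[simp] theorem elems_push (a : DynArray β) (x : β) : (a.push x).val.elems = a.elems.push x := by
  simp only [push, Timed.val_bind, Timed.val_op, decide_eq_true_eq]
  split <;> rfl

theorem cap_push (a : DynArray β) (x : β) :
    (a.push x).val.cap = if a.cap ≤ a.elems.size then 2 * a.cap + 1 else a.cap := by
  simp only [push, Timed.val_bind, Timed.val_op, Timed.val_ite, decide_eq_true_eq]
  split_ifs <;> rfl

theorem time_push (a : DynArray β) (x : β) :
    (a.push x).time = if a.cap ≤ a.elems.size then 2 * a.cap + a.elems.size + 4 else 2 := by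
  simp only [push, Timed.time_bind, Timed.val_op, Timed.time_ite, Timed.time_op, Timed.time_charge,
    decide_eq_true_eq]
  split_ifs <;> omega

theorem WF.push {a : DynArray β} (h : a.WF) (x : β) : (a.push x).val.WF := by
  obtain ⟨size_le, cap_le⟩ := h
  constructor <;> rw [cap_push, elems_push, Array.size_push] <;> split <;> omega

/-- Reallocation is paid for by the growth of the capacity. -/
theorem WF.time_push_add_le {a : DynArray β} (h : a.WF) (x : β) :
    (a.push x).time + 3 * a.cap ≤ 3 * (a.push x).val.cap + 3 := by
  have := h.size_le_cap
  rw [cap_push, time_push]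
  split <;> omega

end DynArray

namespace SLS

/-- `v` is the first element of `F` after position `i`. As a position, `none` is in front of all
numbers; as a value, `none` means that there is no such element. -/
def IsNext (F : ℕ → Prop) (i v : Option ℕ) : Prop :=
  (∀ w ∈ v, F w ∧ ∀ p ∈ i, p < w) ∧ ∀ x, F x → (∀ p ∈ i, p < x) → ∃ w ∈ v, w ≤ x

/-- `v` is the last element of `F` before position `i`. As a position, `none` is behind all numbers;
as a value, `none` means that there is no such element. -/
def IsPrev (F : ℕ → Prop) (i v : Option ℕ) : Prop :=
  (∀ w ∈ v, F w ∧ ∀ p ∈ i, w < p) ∧ ∀ x, F x → (∀ p ∈ i, x < p) → ∃ w ∈ v, x ≤ w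

section Neighbours

variable {F : ℕ → Prop} {i p q v : Option ℕ} {l n : ℕ}

theorem IsNext.erase (hv : IsNext F i v) (hl : F l) (hp : IsPrev F (some l) p)
    (hq : IsNext F (some l) q) (hi : ∀ a ∈ i, F a ∧ a ≠ l) :
    IsNext (fun x => F x ∧ x ≠ l) i (if p = i then q else v) := by
  obtain ⟨p_mem, p_max⟩ := hp
  obtain ⟨q_mem, q_min⟩ := hq
  obtain ⟨v_mem, v_min⟩ := hv
  rcases i with _ | a <;> rcases p with _ | p <;> rcases q with _ | q <;> rcases v with _ | v <;>
    simp [IsNext] at * <;> grind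

theorem IsPrev.erase (hv : IsPrev F i v) (hl : F l) (hp : IsPrev F (some l) p)
    (hq : IsNext F (some l) q) (hi : ∀ a ∈ i, F a ∧ a ≠ l) :
    IsPrev (fun x => F x ∧ x ≠ l) i (if q = i then p else v) := by
  obtain ⟨p_mem, p_max⟩ := hp
  obtain ⟨q_mem, q_min⟩ := hq
  obtain ⟨v_mem, v_max⟩ := hv
  rcases i with _ | a <;> rcases p with _ | p <;> rcases q with _ | q <;> rcases v with _ | v <;>
    simp [IsPrev] at * <;> grind

theorem IsNext.append (hv : IsNext F i v) (hn : ∀ x, F x → x < n) (hp : IsPrev F none p)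
    (hi : ∀ a ∈ i, F a) :
    IsNext (fun x => F x ∨ x = n) i (if p = i then some n else v) := by
  obtain ⟨p_mem, p_max⟩ := hp
  obtain ⟨v_mem, v_min⟩ := hv
  rcases i with _ | a <;> rcases p with _ | p <;> rcases v with _ | v <;>
    simp [IsNext] at * <;> grind

theorem IsPrev.append (hv : IsPrev F (some l) v) (hn : ∀ x, F x → x < n) (hl : F l) :
    IsPrev (fun x => F x ∨ x = n) (some l) v := by
  have := hn l hl
  simp only [IsPrev, Option.mem_some_iff, forall_eq'] at *
  grind

theorem IsPrev.append_last (hv : IsPrev F none v) (hn : ∀ x, F x → x < n) :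
    IsPrev (fun x => F x ∨ x = n) (some n) v := by
  unfold IsPrev at *
  grind

theorem isPrev_none_append (hn : ∀ x, F x → x < n) :
    IsPrev (fun x => F x ∨ x = n) none (some n) :=
  ⟨by simp, fun x hx _ => ⟨n, rfl, hx.elim (fun h => (hn x h).le) le_of_eq⟩⟩

theorem isNext_append_last (hn : ∀ x, F x → x < n) :
    IsNext (fun x => F x ∨ x = n) (some n) none := by
  simp only [IsNext, Option.mem_some_iff, forall_eq']
  grind

end Neighbours

/-- The list node that holds `l`, if `l` is in the list. -/
def node (s : SLS) (l : ℕ) : Option Link := s.ptr.elems[l]?.join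

/-- The linked list of `s` consists of the elements of `F` in increasing order. -/
structure Links (F : ℕ → Prop) (s : SLS) : Prop where
  head : IsNext F none s.head
  tail : IsPrev F none s.tail
  mem : ∀ {l k}, s.node l = some k → F l
  prev : ∀ {l k}, s.node l = some k → IsPrev F (some l) k.prev
  next : ∀ {l k}, s.node l = some k → IsNext F (some l) k.next
  isSome_node : ∀ {l}, F l → (s.node l).isSome

section SetLinks

variable (s : SLS) (i v : Option ℕ)

@[simp] theorem A_setNext : (s.setNext i v).val.A = s.A := by
  unfold setNext
  split
  · rfl
  · rw [Timed.val_bind]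
    split <;> rfl

@[simp] theorem A_setPrev : (s.setPrev i v).val.A = s.A := by
  unfold setPrev
  split
  · rfl
  · rw [Timed.val_bind]
    split <;> rfl

@[simp] theorem tail_setNext : (s.setNext i v).val.tail = s.tail := by
  unfold setNext
  split
  · rfl
  · rw [Timed.val_bind]
    split <;> rfl

@[simp] theorem head_setPrev : (s.setPrev i v).val.head = s.head := by
  unfold setPrev
  split
  · rfl
  · rw [Timed.val_bind]
    split <;> rfl

@[simp] theorem head_setNext : (s.setNext i v).val.head = if i = none then v else s.head := by
  unfold setNext
  split
  · rfl
  · rw [Timed.val_bind]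
    split <;> rfl

@[simp] theorem tail_setPrev : (s.setPrev i v).val.tail = if i = none then v else s.tail := by
  unfold setPrev
  split
  · rfl
  · rw [Timed.val_bind]
    split <;> rfl

@[simp] theorem cap_ptr_setNext : (s.setNext i v).val.ptr.cap = s.ptr.cap := by
  unfold setNext
  split
  · rfl
  · rw [Timed.val_bind]
    split <;> rfl

@[simp] theorem cap_ptr_setPrev : (s.setPrev i v).val.ptr.cap = s.ptr.cap := by
  unfold setPrev
  split
  · rfl
  · rw [Timed.val_bind]
    split <;> rfl

@[simp] theorem size_ptr_setNext :
    (s.setNext i v).val.ptr.elems.size = s.ptr.elems.size := by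
  unfold setNext
  split
  · rfl
  · rw [Timed.val_bind]
    split <;> simp

@[simp] theorem size_ptr_setPrev :
    (s.setPrev i v).val.ptr.elems.size = s.ptr.elems.size := by
  unfold setPrev
  split
  · rfl
  · rw [Timed.val_bind]
    split <;> simp

theorem time_setNext_le : (s.setNext i v).time ≤ 3 := by
  unfold setNext
  split
  · simp
  · rw [Timed.time_bind]
    split <;> simp

theorem time_setPrev_le : (s.setPrev i v).time ≤ 3 := by
  unfold setPrev
  split
  · simp
  · rw [Timed.time_bind]
    split <;> simp

theorem node_setNext (j : ℕ) : (s.setNext i v).val.node j =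
    (s.node j).map fun k => if i = some j then { k with next := v } else k := by
  unfold setNext node
  split
  · simp
  case h_2 p =>
    simp only [Timed.val_bind, DynArray.val_get, Option.some.injEq]
    split
    case h_1 k hk =>
      simp only [Timed.val_bind, Timed.val_op, DynArray.elems_set, Array.getElem?_setIfInBounds]
      obtain ⟨hp, hpk⟩ := Array.getElem?_eq_some_iff.1 hk
      by_cases hj : p = j
      · subst hj
        simp [hp, hpk]
      · simp [hj]
    case h_2 hp =>
      by_cases hj : p = j
      · subst hj
        rcases hc : s.ptr.elems[p]? with _ | _ | k
        · simp
        · simp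
        · exact absurd hc (hp k)
      · simp [hj]

theorem node_setPrev (j : ℕ) : (s.setPrev i v).val.node j =
    (s.node j).map fun k => if i = some j then { k with prev := v } else k := by
  unfold setPrev node
  split
  · simp
  case h_2 p =>
    simp only [Timed.val_bind, DynArray.val_get, Option.some.injEq]
    split
    case h_1 k hk =>
      simp only [Timed.val_bind, Timed.val_op, DynArray.elems_set, Array.getElem?_setIfInBounds]
      obtain ⟨hp, hpk⟩ := Array.getElem?_eq_some_iff.1 hk
      by_cases hj : p = j
      · subst hj
        simp [hp, hpk]
      · simp [hj]
    case h_2 hp =>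
      by_cases hj : p = j
      · subst hj
        rcases hc : s.ptr.elems[p]? with _ | _ | k
        · simp
        · simp
        · exact absurd hc (hp k)
      · simp [hj]

end SetLinks

section Unlink

variable (s : SLS) (l : ℕ)

theorem val_unlink {s : SLS} {l : ℕ} {k : Link} (hk : s.node l = some k) :
    (s.unlink l).val =
      let s' := ((s.setNext k.prev k.next).val.setPrev k.next k.prev).val
      { s' with ptr := (s'.ptr.set l none).val } := by
  rw [node, Option.join_eq_some_iff] at hk
  simp only [unlink, Timed.val_bind, DynArray.val_get, hk]
  rfl

theorem val_unlink_of_node_eq_none {s : SLS} {l : ℕ} (hl : s.node l = none) :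
    (s.unlink l).val = s := by
  simp only [unlink, Timed.val_bind, DynArray.val_get]
  split
  case h_1 k hk => simp [node, hk] at hl
  case h_2 => rfl

@[simp] theorem A_unlink : (s.unlink l).val.A = s.A := by
  rcases hl : s.node l with _ | k
  · rw [val_unlink_of_node_eq_none hl]
  · simp [val_unlink hl]

@[simp] theorem cap_ptr_unlink : (s.unlink l).val.ptr.cap = s.ptr.cap := by
  rcases hl : s.node l with _ | k
  · rw [val_unlink_of_node_eq_none hl]
  · simp [val_unlink hl]

@[simp] theorem size_ptr_unlink : (s.unlink l).val.ptr.elems.size = s.ptr.elems.size := by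
  rcases hl : s.node l with _ | k
  · rw [val_unlink_of_node_eq_none hl]
  · simp [val_unlink hl]

theorem time_unlink_le : (s.unlink l).time ≤ 9 := by
  simp only [unlink, Timed.time_bind, DynArray.time_get]
  split
  case h_1 k _ =>
    have := s.time_setNext_le k.prev k.next
    have := (s.setNext k.prev k.next).val.time_setPrev_le k.next k.prev
    simp only [Timed.time_bind, DynArray.time_set, Timed.time_op]
    omega
  case h_2 => simp

theorem node_unlink {s : SLS} {l : ℕ} {k : Link} (hk : s.node l = some k) (j : ℕ) :
    (s.unlink l).val.node j = if j = l then none else (s.node j).map fun m =>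
      ⟨if k.next = some j then k.prev else m.prev, if k.prev = some j then k.next else m.next⟩ := by
  rw [val_unlink hk]
  by_cases hj : j = l
  · subst hj
    simp only [node, DynArray.elems_set, Array.getElem?_setIfInBounds_self, if_true]
    split <;> rfl
  · trans ((s.setNext k.prev k.next).val.setPrev k.next k.prev).val.node j
    · simp only [node, DynArray.elems_set, Array.getElem?_setIfInBounds_ne (Ne.symm hj)]
    rw [if_neg hj, node_setPrev, node_setNext, Option.map_map]
    congr 1
    funext m
    simp only [Function.comp_apply]
    split_ifs <;> rfl

theorem Links.unlink {F : ℕ → Prop} {s : SLS} (h : Links F s) (l : ℕ) :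
    Links (fun x => F x ∧ x ≠ l) (s.unlink l).val := by
  rcases hl : s.node l with _ | k
  · have hF : (fun x => F x ∧ x ≠ l) = F := by
      funext x
      refine propext ⟨And.left, fun hx => ⟨hx, ?_⟩⟩
      rintro rfl
      simpa [hl] using h.isSome_node hx
    rwa [hF, val_unlink_of_node_eq_none hl]
  have hFl := h.mem hl
  have hp := h.prev hl
  have hq := h.next hl
  have of_node {j m} (hm : (s.unlink l).val.node j = some m) : j ≠ l ∧ ∃ m', s.node j = some m' ∧
      m = ⟨if k.next = some j then k.prev else m'.prev,
        if k.prev = some j then k.next else m'.next⟩ := by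
    rw [node_unlink hl] at hm
    by_cases hj : j = l
    · simp [hj] at hm
    rw [if_neg hj] at hm
    obtain ⟨m', hm', rfl⟩ := Option.map_eq_some_iff.1 hm
    exact ⟨hj, m', hm', rfl⟩
  refine ⟨?_, ?_, fun hm => ?_, fun hm => ?_, fun hm => ?_, fun hj => ?_⟩
  · simpa [val_unlink hl] using h.head.erase hFl hp hq (by simp)
  · simpa [val_unlink hl] using h.tail.erase hFl hp hq (by simp)
  · obtain ⟨hj, m', hm', -⟩ := of_node hm
    exact ⟨h.mem hm', hj⟩
  · obtain ⟨hj, m', hm', rfl⟩ := of_node hm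
    exact (h.prev hm').erase hFl hp hq (by simpa using ⟨h.mem hm', hj⟩)
  · obtain ⟨hj, m', hm', rfl⟩ := of_node hm
    exact (h.next hm').erase hFl hp hq (by simpa using ⟨h.mem hm', hj⟩)
  · simpa [node_unlink hl, hj.2] using h.isSome_node hj.1

end Unlink

section Grow

variable (s : SLS)

theorem val_grow : s.grow.val =
    let n := s.A.elems.size
    let s' : SLS := { s with
      A := (s.A.push false).val, ptr := (s.ptr.push (some ⟨s.tail, none⟩)).val }
    { (s'.setNext s.tail (some n)).val with tail := some n } := rfl

@[simp] theorem A_grow : s.grow.val.A = (s.A.push false).val := by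
  simp [val_grow]

@[simp] theorem cap_ptr_grow :
    s.grow.val.ptr.cap = (s.ptr.push (some ⟨s.tail, none⟩)).val.cap := by
  simp [val_grow]

@[simp] theorem size_ptr_grow : s.grow.val.ptr.elems.size = s.ptr.elems.size + 1 := by
  simp [val_grow]

theorem time_grow_le :
    s.grow.time ≤ (s.A.push false).time + (s.ptr.push (some ⟨s.tail, none⟩)).time + 6 := by
  have := SLS.time_setNext_le
    ⟨(s.A.push false).val, (s.ptr.push (some ⟨s.tail, none⟩)).val, s.head, s.tail⟩
    s.tail (some s.A.elems.size)
  simp only [grow, Timed.time_bind, DynArray.time_size, DynArray.val_size, Timed.time_op,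
    Timed.val_op]
  omega

theorem node_grow {s : SLS} (hsize : s.ptr.elems.size = s.A.elems.size)
    (htail : s.tail ≠ some s.A.elems.size) (j : ℕ) :
    s.grow.val.node j = if j = s.A.elems.size then some ⟨s.tail, none⟩ else (s.node j).map
      fun k => if s.tail = some j then { k with next := some s.A.elems.size } else k := by
  trans (SLS.setNext
    ⟨(s.A.push false).val, (s.ptr.push (some ⟨s.tail, none⟩)).val, s.head, s.tail⟩
    s.tail (some s.A.elems.size)).val.node j
  · rfl
  rw [node_setNext]
  by_cases hj : j = s.A.elems.size
  · subst hj
    simp [node, ← hsize] at htail ⊢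
    simp [htail]
  · simp [node, Array.getElem?_push, hsize, hj]

theorem Links.grow {F : ℕ → Prop} {s : SLS} (h : Links F s)
    (hsize : s.ptr.elems.size = s.A.elems.size) (hF : ∀ x, F x → x < s.A.elems.size) :
    Links (fun x => F x ∨ x = s.A.elems.size) s.grow.val := by
  have htail : s.tail ≠ some s.A.elems.size := fun ht =>
    (hF _ (h.tail.1 _ ht).1).false
  have of_node {j m} (hm : s.grow.val.node j = some m) :
      j = s.A.elems.size ∧ m = ⟨s.tail, none⟩ ∨ ∃ m', s.node j = some m' ∧
        m = ⟨m'.prev, if s.tail = some j then some s.A.elems.size else m'.next⟩ := by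
    rw [node_grow hsize htail] at hm
    by_cases hj : j = s.A.elems.size
    · rw [if_pos hj] at hm
      exact .inl ⟨hj, (Option.some.inj hm).symm⟩
    · rw [if_neg hj] at hm
      obtain ⟨m', hm', rfl⟩ := Option.map_eq_some_iff.1 hm
      exact .inr ⟨m', hm', by split_ifs <;> rfl⟩
  refine ⟨?_, ?_, fun hm => ?_, fun hm => ?_, fun hm => ?_, fun {j} hj => ?_⟩
  · simpa [val_grow] using h.head.append hF h.tail (by simp)
  · exact isPrev_none_append hF
  · obtain ⟨rfl, -⟩ | ⟨m', hm', -⟩ := of_node hm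
    · exact .inr rfl
    · exact .inl (h.mem hm')
  · obtain ⟨rfl, rfl⟩ | ⟨m', hm', rfl⟩ := of_node hm
    · exact h.tail.append_last hF
    · exact (h.prev hm').append hF (h.mem hm')
  · obtain ⟨rfl, rfl⟩ | ⟨m', hm', rfl⟩ := of_node hm
    · exact isNext_append_last hF
    · exact (h.next hm').append hF h.tail (by simpa using h.mem hm')
  · rw [node_grow hsize htail]
    by_cases hjn : j = s.A.elems.size
    · rw [if_pos hjn]
      rfl
    · rw [if_neg hjn]
      exact Option.isSome_map.trans (h.isSome_node (hj.resolve_right hjn))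

end Grow

/-- Some interval of level `l` is recorded in `s`. -/
def Marked (s : SLS) (l : ℕ) : Prop := s.A.elems[l]? = some true

/-- The level `l` is within the range of the array `A` of `s`, and no interval of level `l` is
recorded in `s`. -/
def Free (s : SLS) (l : ℕ) : Prop := s.A.elems[l]? = some false

/-- The invariant of supporting line segments. -/
structure Valid (s : SLS) : Prop where
  wf_A : s.A.WF
  wf_ptr : s.ptr.WF
  size_ptr : s.ptr.elems.size = s.A.elems.size
  links : Links s.Free s

theorem Free.lt_size {s : SLS} {l : ℕ} (h : s.Free l) : l < s.A.elems.size :=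
  (Array.getElem?_eq_some_iff.1 h).1

theorem Marked.not_free {s : SLS} {l : ℕ} (h : s.Marked l) : ¬ s.Free l := fun hf => by
  simp only [Marked, Free] at h hf
  simp [h] at hf

theorem marked_of_not_free {s : SLS} {l : ℕ} (hl : l < s.A.elems.size) (h : ¬ s.Free l) :
    s.Marked l := by
  simpa [Free, Marked, hl] using h

theorem Valid.empty : SLS.empty.Valid := by
  refine ⟨.empty, .empty, rfl, ?_, ?_, ?_, ?_, ?_, ?_⟩ <;>
    simp [SLS.empty, DynArray.empty, Free, IsNext, IsPrev, node]

/-- The potential of the amortized analysis of supporting line segments. Its growth pays for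
extending them: that of the capacities for reallocations, that of the size for the other steps. -/
def pot (s : SLS) : ℕ := 12 * s.A.elems.size + 3 * s.A.cap + 3 * s.ptr.cap

theorem Valid.pot_le {s : SLS} (h : s.Valid) : s.pot ≤ 24 * s.A.elems.size := by
  have cap_A_le := h.wf_A.cap_le
  have cap_ptr_le := h.wf_ptr.cap_le
  rw [h.size_ptr] at cap_ptr_le
  unfold pot
  omega

theorem free_grow (s : SLS) : s.grow.val.Free = fun x => s.Free x ∨ x = s.A.elems.size := by
  funext x
  by_cases hx : x = s.A.elems.size <;> simp [Free, Array.getElem?_push, hx]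

theorem marked_grow (s : SLS) (l : ℕ) : s.grow.val.Marked l ↔ s.Marked l := by
  by_cases hl : l = s.A.elems.size <;> simp [Marked, Array.getElem?_push, hl]

theorem Valid.grow {s : SLS} (h : s.Valid) : s.grow.val.Valid where
  wf_A := by simpa using h.wf_A.push false
  wf_ptr := by
    have := h.wf_ptr.push (some ⟨s.tail, none⟩)
    exact ⟨by simpa using this.size_le_cap, by simpa using this.cap_le⟩
  size_ptr := by simp [h.size_ptr]
  links := free_grow s ▸ h.links.grow h.size_ptr fun _ => Free.lt_size

theorem Valid.time_grow_add_pot_le {s : SLS} (h : s.Valid) :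
    s.grow.time + s.pot ≤ s.grow.val.pot := by
  have := s.time_grow_le
  have := h.wf_A.time_push_add_le false
  have := h.wf_ptr.time_push_add_le (some ⟨s.tail, none⟩)
  simp only [pot, A_grow, cap_ptr_grow, DynArray.elems_push, Array.size_push]
  omega

theorem Valid.growBy {s : SLS} (h : s.Valid) (k : ℕ) : (growBy k s).val.Valid := by
  induction k generalizing s with
  | zero => exact h
  | succ _ ih => exact ih h.grow

@[simp] theorem size_A_growBy (s : SLS) (k : ℕ) :
    (growBy k s).val.A.elems.size = s.A.elems.size + k := by
  induction k generalizing s with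
  | zero => rfl
  | succ k ih => simp [growBy, ih, add_assoc, add_comm 1 k]

theorem marked_growBy (s : SLS) (k l : ℕ) : (growBy k s).val.Marked l ↔ s.Marked l := by
  induction k generalizing s with
  | zero => rfl
  | succ k ih => exact (ih _).trans (s.marked_grow l)

theorem Valid.time_growBy_add_pot_le {s : SLS} (h : s.Valid) (k : ℕ) :
    (SLS.growBy k s).time + s.pot ≤ (SLS.growBy k s).val.pot + 1 := by
  induction k generalizing s with
  | zero => simp [SLS.growBy, add_comm]
  | succ k ih =>
    have := h.time_grow_add_pot_le
    have := ih h.grow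
    simp only [SLS.growBy, Timed.val_bind, Timed.time_bind]
    omega

section Mark

variable (s : SLS)

theorem elems_A_mark (l : ℕ) :
    (s.mark l).val.A.elems = s.A.elems.setIfInBounds l true := by
  simp [mark]

@[simp] theorem size_A_mark (l : ℕ) : (s.mark l).val.A.elems.size = s.A.elems.size := by
  simp [elems_A_mark]

theorem pot_mark (l : ℕ) : (s.mark l).val.pot = s.pot := by
  simp [pot, mark]

theorem time_mark_le (l : ℕ) : (s.mark l).time ≤ 11 := by
  have := SLS.time_unlink_le { s with A := (s.A.set l true).val } l
  simp only [mark, Timed.time_bind, DynArray.time_set, Timed.time_op, Timed.val_op]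
  omega

theorem marked_mark {s : SLS} {l : ℕ} (hl : l < s.A.elems.size) (j : ℕ) :
    (s.mark l).val.Marked j ↔ s.Marked j ∨ j = l := by
  by_cases hj : j = l
  · subst hj
    simp [Marked, elems_A_mark, hl]
  · simp [Marked, elems_A_mark, Array.getElem?_setIfInBounds_ne (Ne.symm hj), hj]

theorem free_mark (l : ℕ) : (s.mark l).val.Free = fun x => s.Free x ∧ x ≠ l := by
  funext j
  by_cases hj : j = l
  · subst hj
    simp [Free, elems_A_mark, Array.getElem?_setIfInBounds_self]
  · simp [Free, elems_A_mark, Array.getElem?_setIfInBounds_ne (Ne.symm hj), hj]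

theorem Valid.mark {s : SLS} (h : s.Valid) (l : ℕ) : (s.mark l).val.Valid where
  wf_A := by simpa [SLS.mark] using h.wf_A.set l true
  wf_ptr := ⟨by simpa [SLS.mark] using h.wf_ptr.size_le_cap,
    by simpa [SLS.mark] using h.wf_ptr.cap_le⟩
  size_ptr := by simp [SLS.mark, h.size_ptr]
  links := by
    have : Links s.Free { s with A := (s.A.set l true).val } :=
      ⟨h.links.head, h.links.tail, h.links.mem, h.links.prev, h.links.next, h.links.isSome_node⟩
    exact free_mark s l ▸ this.unlink l

theorem Valid.markAll {s : SLS} (h : s.Valid) (ls : List ℕ) : (markAll ls s).val.Valid := by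
  induction ls generalizing s with
  | nil => exact h
  | cons l _ ih => exact ih (h.mark l)

@[simp] theorem size_A_markAll (ls : List ℕ) :
    (markAll ls s).val.A.elems.size = s.A.elems.size := by
  induction ls generalizing s with
  | nil => rfl
  | cons l _ ih => exact (ih _).trans (s.size_A_mark l)

theorem pot_markAll (ls : List ℕ) : (markAll ls s).val.pot = s.pot := by
  induction ls generalizing s with
  | nil => rfl
  | cons l _ ih => exact (ih _).trans (s.pot_mark l)

theorem marked_markAll {s : SLS} {ls : List ℕ} (hls : ∀ l ∈ ls, l < s.A.elems.size) (j : ℕ) :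
    (markAll ls s).val.Marked j ↔ s.Marked j ∨ j ∈ ls := by
  induction ls generalizing s with
  | nil => simp [markAll]
  | cons l ls ih =>
    rw [List.forall_mem_cons] at hls
    simp only [markAll, Timed.val_bind]
    rw [ih (by simpa using hls.2), marked_mark hls.1, List.mem_cons, or_assoc]

theorem time_markAll_le (ls : List ℕ) : (markAll ls s).time ≤ 11 * ls.length + 1 := by
  induction ls generalizing s with
  | nil => simp [markAll]
  | cons l ls ih =>
    have := s.time_mark_le l
    have := ih (s.mark l).val
    simp only [markAll, Timed.time_bind, List.length_cons]
    omega

end Mark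

theorem time_height_le (s : SLS) : s.height.time ≤ 2 := by
  simp only [height, Timed.time_bind, Timed.time_op, Timed.val_op]
  split <;> simp

theorem val_height (s : SLS) : s.height.val = s.head.getD s.A.elems.size := by
  simp only [height, Timed.val_bind, Timed.val_op]
  split
  case h_1 v hv => rw [hv]; rfl
  case h_2 hv => rw [hv]; rfl

theorem Valid.isLeast_height {s : SLS} (h : s.Valid) :
    IsLeast {y | ¬ s.Marked y} s.height.val := by
  rw [val_height]
  rcases hs : s.head with _ | v
  · have hfree (y : ℕ) : ¬ s.Free y := fun hy => by
      simpa [hs] using h.links.head.2 y hy (by simp)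
    refine ⟨by simp [Marked], fun y hy => ?_⟩
    by_contra! hlt
    exact hy (marked_of_not_free hlt (hfree y))
  · have hv : s.Free v := (h.links.head.1 v hs).1
    refine ⟨fun hm => hm.not_free hv, fun y hy => ?_⟩
    by_contra! hlt
    refine hy (marked_of_not_free (hlt.trans hv.lt_size) fun hf => ?_)
    obtain ⟨w, hw, hwy⟩ := h.links.head.2 y hf (by simp)
    rw [hs, Option.mem_some_iff] at hw
    simp only [Option.getD_some] at hlt
    omega

end SLS

/-! ### The colouring of KT-SLS -/

section KTSLS

variable {α : Type} [LinearOrder α]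

theorem meets_iff {J K : NonemptyInterval α} : Meets J K ↔ J.fst ≤ K.snd ∧ K.fst ≤ J.snd := by
  constructor
  · rintro ⟨t, htJ, htK⟩
    exact ⟨htJ.1.trans htK.2, htK.1.trans htJ.2⟩
  · rintro ⟨hJK, hKJ⟩
    exact ⟨max J.fst K.fst, ⟨le_max_left _ _, max_le J.fst_le_snd hKJ⟩,
      ⟨le_max_right _ _, max_le hJK K.fst_le_snd⟩⟩

theorem Meets.symm {J K : NonemptyInterval α} (h : Meets J K) : Meets K J :=
  h.imp fun _ => And.symm

theorem not_meets_of_lt_fst {J K M : NonemptyInterval α} {s t : α} (hsJ : s ∈ J) (hsK : s < K.fst)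
    (htK : t ∈ K) (htJ : t ∉ J) (htM : t ∉ M) (hKM : K.snd ≤ M.snd) : ¬ Meets M J := fun h => by
  have hJt : J.snd < t := by
    by_contra! hle
    exact htJ ⟨hsJ.1.trans (hsK.le.trans htK.1), hle⟩
  exact htM ⟨(meets_iff.1 h).1.trans hJt.le, htK.2.trans hKM⟩

theorem not_meets_of_snd_lt {J K M : NonemptyInterval α} {s t : α} (hsJ : s ∈ J) (hsK : K.snd < s)
    (htK : t ∈ K) (htJ : t ∉ J) (htM : t ∉ M) (hMK : M.fst ≤ K.fst) : ¬ Meets M J := fun h => by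
  have htJ' : t < J.fst := by
    by_contra! hle
    exact htJ ⟨hle, (htK.2.trans hsK.le).trans hsJ.2⟩
  exact htM ⟨hMK.trans htK.1, htJ'.le.trans (meets_iff.1 h).2⟩

variable {I : ℕ → NonemptyInterval α} {L o : ℕ → ℕ}

theorem isLeast_slsHeight (I : ℕ → NonemptyInterval α) (L : ℕ → ℕ) (i : ℕ) (t : α) :
    IsLeast {y | ∀ j < i, t ∈ I j → L j ≠ y} (slsHeight I L i t) := by
  refine ⟨Nat.sInf_mem ⟨(Finset.range i).sup L + 1, fun j hj _ => ?_⟩, fun y hy => Nat.sInf_le hy⟩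
  exact (Nat.lt_succ_of_le (Finset.le_sup (f := L) (Finset.mem_range.2 hj))).ne

theorem ne_slsHeight {i j : ℕ} {t : α} (hj : j < i) (ht : t ∈ I j) : L j ≠ slsHeight I L i t :=
  (isLeast_slsHeight I L i t).1 j hj ht

theorem exists_of_lt_slsHeight {i y : ℕ} {t : α} (h : y < slsHeight I L i t) :
    ∃ j < i, t ∈ I j ∧ L j = y := by
  by_contra! hy
  exact h.not_ge ((isLeast_slsHeight I L i t).2 hy)

theorem slsHeight_le_slsHeight {i i' : ℕ} {t t' : α}
    (h : ∀ j < i, t ∈ I j → j < i' ∧ t' ∈ I j) : slsHeight I L i t ≤ slsHeight I L i' t' :=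
  (isLeast_slsHeight I L i t).2 fun j hj ht => ne_slsHeight (h j hj ht).1 (h j hj ht).2

open Classical in
theorem slsHeight_le_card (I : ℕ → NonemptyInterval α) (L : ℕ → ℕ) (i : ℕ) (t : α) :
    slsHeight I L i t ≤ ((Finset.range i).filter fun j => t ∈ I j).card := by
  have : Finset.range (slsHeight I L i t) ⊆
      ((Finset.range i).filter fun j => t ∈ I j).image L := fun y hy => by
    obtain ⟨j, hj, ht, rfl⟩ := exists_of_lt_slsHeight (Finset.mem_range.1 hy)
    exact Finset.mem_image_of_mem L (by simp [hj, ht])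
  simpa using (Finset.card_le_card this).trans Finset.card_image_le

/-- `L` gives the levels that algorithm KT-SLS computes for the sequence `I`; this part of `IsKTSLS`
does not involve the offsets. -/
def IsLevel (I : ℕ → NonemptyInterval α) (L : ℕ → ℕ) : Prop :=
  ∀ i, IsGreatest {h | ∃ t ∈ I i, h = slsHeight I L i t} (L i)

namespace IsLevel

/-- The point at which the level of `I i` is attained lies in no earlier interval of this level by
the definition of the height, and in no later one because that one would then be higher. -/
theorem exists_private_point (hL : IsLevel I L) (i : ℕ) :
    ∃ s ∈ I i, ∀ j, j ≠ i → L j = L i → s ∉ I j := by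
  obtain ⟨⟨s, hs, hsL⟩, -⟩ := hL i
  refine ⟨s, hs, fun j hji hj hsj => ?_⟩
  rcases lt_or_gt_of_ne hji with hlt | hlt
  · exact ne_slsHeight hlt hsj (hj.trans hsL)
  · have : slsHeight I L i s ≤ slsHeight I L j s :=
      slsHeight_le_slsHeight fun k hk hsk => ⟨hk.trans hlt, hsk⟩
    have : L i ≠ slsHeight I L j s := ne_slsHeight hlt hs
    have : slsHeight I L j s ≤ L j := (hL j).2 ⟨s, hsj, rfl⟩
    omega

/-- The intervals of the level of `I i` that meet `I i` lie to the left or to the right of a private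
point of `I i`. Of two on the same side, the one reaching further would contain every private point
of the other. -/
theorem encard_meets_le_two (hL : IsLevel I L) (i : ℕ) :
    {j | j ≠ i ∧ L j = L i ∧ Meets (I j) (I i)}.encard ≤ 2 := by
  classical
  choose s hs hs_private using hL.exists_private_point
  have hinj : Set.InjOn (fun j => decide (s i < (I j).fst))
      {j | j ≠ i ∧ L j = L i ∧ Meets (I j) (I i)} := by
    rintro j ⟨hji, hj, hmj⟩ k ⟨hki, hk, hmk⟩ hside
    rw [decide_eq_decide] at hside
    by_contra hjk
    have hsj_i := hs_private j i hji.symm hj.symm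
    have hsk_i := hs_private k i hki.symm hk.symm
    have hsj_k := hs_private j k (Ne.symm hjk) (hk.trans hj.symm)
    have hsk_j := hs_private k j hjk (hj.trans hk.symm)
    have snd_lt {m} (hmi : m ≠ i) (hm : L m = L i) (h : ¬ s i < (I m).fst) : (I m).snd < s i := by
      by_contra! hle
      exact hs_private i m hmi hm ⟨not_lt.1 h, hle⟩
    by_cases hright : s i < (I j).fst
    · rcases le_total (I j).snd (I k).snd with hle | hle
      · exact not_meets_of_lt_fst (hs i) hright (hs j) hsj_i hsj_k hle hmk
      · exact not_meets_of_lt_fst (hs i) (hside.1 hright) (hs k) hsk_i hsk_j hle hmj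
    · rcases le_total (I k).fst (I j).fst with hle | hle
      · exact not_meets_of_snd_lt (hs i) (snd_lt hji hj hright) (hs j) hsj_i hsj_k hle hmk
      · exact not_meets_of_snd_lt (hs i) (snd_lt hki hk (mt hside.2 hright)) (hs k) hsk_i hsk_j hle
          hmj
  calc _ ≤ (Set.univ : Set Bool).encard :=
        Set.encard_le_encard_of_injOn (Set.mapsTo_univ _ _) hinj
    _ = 2 := by rw [Set.encard_univ, ENat.card_eq_coe_fintype_card, Fintype.card_bool]; rfl

theorem exists_free_offset (hL : IsLevel I L) (o : ℕ → ℕ) (i : ℕ) :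
    (({1, 2, 3} : Set ℕ) \ {c | ∃ j < i, Meets (I j) (I i) ∧ L j = L i ∧ o j = c}).Nonempty := by
  by_contra hne
  rw [Set.not_nonempty_iff_eq_empty, Set.sdiff_eq_empty] at hne
  have hsub : ({1, 2, 3} : Set ℕ) ⊆ o '' {j | j ≠ i ∧ L j = L i ∧ Meets (I j) (I i)} := by
    intro c hc
    obtain ⟨j, hj, hm, hl, rfl⟩ := hne hc
    exact ⟨j, ⟨hj.ne, hl, hm⟩, rfl⟩
  have := (Set.encard_le_encard hsub).trans
    ((Set.encard_image_le _ _).trans (hL.encard_meets_le_two i))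
  rw [Set.encard_insert_of_notMem (by simp), Set.encard_pair (by simp)] at this
  norm_num at this

theorem not_meets_of_eq_zero (hL : IsLevel I L) {i j : ℕ} (hij : j < i) (hj : L j = 0)
    (hi : L i = 0) : ¬ Meets (I j) (I i) := by
  rintro ⟨t, htj, hti⟩
  have : slsHeight I L i t ≤ L i := (hL i).2 ⟨t, hti, rfl⟩
  have : L j ≠ slsHeight I L i t := ne_slsHeight hij htj
  omega

open Classical in
theorem exists_lt_card (hL : IsLevel I L) (i : ℕ) :
    ∃ t ∈ I i, L i < ((Finset.range (i + 1)).filter fun j => t ∈ I j).card := by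
  obtain ⟨⟨t, ht, hLt⟩, -⟩ := hL i
  refine ⟨t, ht, ?_⟩
  rw [Finset.range_add_one, Finset.filter_insert, if_pos ht,
    Finset.card_insert_of_notMem (by simp), hLt, Nat.lt_succ_iff]
  exact slsHeight_le_card I L i t

end IsLevel

/-- The level that KT-SLS gives to the `i`-th interval, by recursion on `i`. -/
noncomputable def ktLevel (I : ℕ → NonemptyInterval α) (i : ℕ) : ℕ :=
  sSup {h | ∃ t ∈ I i, h = sInf {y : ℕ | ∀ j, (_ : j < i) → t ∈ I j → ktLevel I j ≠ y}}
termination_by i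

/-- The offset that KT-SLS gives to the `i`-th interval for given levels, by recursion on `i`. -/
noncomputable def ktOffset (I : ℕ → NonemptyInterval α) (L : ℕ → ℕ) (i : ℕ) : ℕ :=
  sInf (({1, 2, 3} : Set ℕ) \
    {c | ∃ j, ∃ (_ : j < i), Meets (I j) (I i) ∧ L j = L i ∧ ktOffset I L j = c})
termination_by i

theorem isLevel_ktLevel (I : ℕ → NonemptyInterval α) : IsLevel I (ktLevel I) := fun i => by
  classical
  have hne : {h | ∃ t ∈ I i, h = slsHeight I (ktLevel I) i t}.Nonempty :=
    ⟨_, (I i).fst, ⟨le_rfl, (I i).fst_le_snd⟩, rfl⟩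
  have hbdd : BddAbove {h | ∃ t ∈ I i, h = slsHeight I (ktLevel I) i t} := by
    refine ⟨i, ?_⟩
    rintro h ⟨t, -, rfl⟩
    simpa using (slsHeight_le_card I (ktLevel I) i t).trans (Finset.card_filter_le _ _)
  have hsup : ktLevel I i = sSup {h | ∃ t ∈ I i, h = slsHeight I (ktLevel I) i t} := by
    rw [ktLevel]
    rfl
  rw [hsup]
  exact ⟨Nat.sSup_mem hne hbdd, fun h hh => le_csSup hbdd hh⟩

theorem isKTSLS_ktLevel_ktOffset (I : ℕ → NonemptyInterval α) :
    IsKTSLS I (ktLevel I) (ktOffset I (ktLevel I)) where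
  level := isLevel_ktLevel I
  offset i := by
    have hinf : ktOffset I (ktLevel I) i = sInf (({1, 2, 3} : Set ℕ) \
        {c | ∃ j < i, Meets (I j) (I i) ∧ ktLevel I j = ktLevel I i ∧
          ktOffset I (ktLevel I) j = c}) := by
      rw [ktOffset]
      simp only [exists_prop]
    rw [hinf]
    exact ⟨Nat.sInf_mem ((isLevel_ktLevel I).exists_free_offset _ i), fun c hc => Nat.sInf_le hc⟩

open Classical in
theorem card_filter_mem_le_cliqueNum (I : ℕ → NonemptyInterval α) (n : ℕ) (t : α) :
    ((Finset.range n).filter fun j => t ∈ I j).card ≤ (intervalGraph I n).cliqueNum := by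
  set S := (Finset.range n).filter fun j => t ∈ I j
  have hS : ∀ j ∈ S, j < n := fun j hj => Finset.mem_range.1 (Finset.mem_filter.1 hj).1
  have hclique : (intervalGraph I n).IsClique (S.attachFin hS) := fun a ha b hb hab => by
    rw [Finset.mem_coe, Finset.mem_attachFin, Finset.mem_filter] at ha hb
    exact ⟨hab, t, ha.2, hb.2⟩
  simpa using hclique.card_le_cliqueNum

open Classical in
theorem card_filter_meets_le_maxDeg_add_one (I : ℕ → NonemptyInterval α) {n i : ℕ} (hi : i < n) :
    ((Finset.range n).filter fun j => Meets (I j) (I i)).card ≤ maxDeg I n + 1 := by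
  set S := ((Finset.range n).filter fun j => Meets (I j) (I i)).erase i
  have hS : ∀ j ∈ S, j < n := fun j hj =>
    Finset.mem_range.1 (Finset.mem_filter.1 (Finset.mem_of_mem_erase hj)).1
  have hsub : S.attachFin hS ⊆ (intervalGraph I n).neighborFinset ⟨i, hi⟩ := fun j hj => by
    rw [Finset.mem_attachFin, Finset.mem_erase, Finset.mem_filter] at hj
    rw [SimpleGraph.mem_neighborFinset]
    exact ⟨fun hij => hj.1 (congrArg Fin.val hij).symm, hj.2.2.symm⟩
  have hcard := Finset.card_le_card hsub
  rw [Finset.card_attachFin, SimpleGraph.card_neighborFinset_eq_degree] at hcard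
  have := hcard.trans ((intervalGraph I n).degree_le_maxDegree ⟨i, hi⟩)
  exact Nat.sub_le_iff_le_add.1 (Finset.pred_card_le_card_erase.trans this)

theorem IsLevel.lt_cliqueNum (hL : IsLevel I L) {n i : ℕ} (hi : i < n) :
    L i < (intervalGraph I n).cliqueNum := by
  classical
  obtain ⟨t, -, hlt⟩ := hL.exists_lt_card i
  refine hlt.trans_le ((Finset.card_le_card ?_).trans (card_filter_mem_le_cliqueNum I n t))
  exact Finset.filter_subset_filter _ (Finset.range_subset_range.2 hi)

theorem IsLevel.le_maxDeg (hL : IsLevel I L) {n i : ℕ} (hi : i < n) : L i ≤ maxDeg I n := by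
  classical
  obtain ⟨t, ht, hlt⟩ := hL.exists_lt_card i
  refine Nat.lt_succ_iff.1 (hlt.trans_le
    ((Finset.card_le_card fun j hj => ?_).trans (card_filter_meets_le_maxDeg_add_one I hi)))
  rw [Finset.mem_filter, Finset.mem_range] at hj ⊢
  exact ⟨hj.1.trans_le hi, t, hj.2, ht⟩

namespace IsKTSLS

theorem isLevel (h : IsKTSLS I L o) : IsLevel I L := h.level

theorem offset_mem (h : IsKTSLS I L o) (i : ℕ) : o i ∈ ({1, 2, 3} : Finset ℕ) := by
  simpa using (h.offset i).1.1

theorem color_ne_of_meets (h : IsKTSLS I L o) {i j : ℕ} (hij : i ≠ j) (hm : Meets (I i) (I j)) :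
    (L i, o i) ≠ (L j, o j) := by
  wlog hlt : i < j generalizing i j
  · exact (this hij.symm hm.symm (hij.lt_or_gt.resolve_left hlt)).symm
  intro heq
  obtain ⟨hL, ho⟩ := Prod.mk.inj heq
  exact (h.offset j).1.2 ⟨i, hlt, hm, hL, ho⟩

theorem offset_eq_one (h : IsKTSLS I L o) {i : ℕ} (hi : L i = 0) : o i = 1 := by
  have hle : o i ≤ 1 := by
    refine (h.offset i).2 ⟨by simp, ?_⟩
    rintro ⟨j, hj, hm, hl, -⟩
    exact h.isLevel.not_meets_of_eq_zero hj (hl.trans hi) hi hm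
  have := h.offset_mem i
  simp only [Finset.mem_insert, Finset.mem_singleton] at this
  omega

/-- There are at most three colours for each of the levels `1, …, ω - 1`, and only one for level
`0`. -/
theorem card_colors_add_two_le (h : IsKTSLS I L o) {n : ℕ} (hn : 1 ≤ n) :
    ((Finset.range n).image fun i => (L i, o i)).card + 2 ≤
      3 * (intervalGraph I n).cliqueNum := by
  set ω := (intervalGraph I n).cliqueNum
  have hω : 0 < ω := (Nat.zero_le _).trans_lt (h.isLevel.lt_cliqueNum hn)
  have hsub : ((Finset.range n).image fun i => (L i, o i)) ⊆
      insert (0, 1) (Finset.Ico 1 ω ×ˢ ({1, 2, 3} : Finset ℕ)) := fun c hc => by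
    obtain ⟨i, hi, rfl⟩ := Finset.mem_image.1 hc
    rw [Finset.mem_insert]
    rcases Nat.eq_zero_or_pos (L i) with h0 | hpos
    · exact .inl (by rw [h0, h.offset_eq_one h0])
    · exact .inr (Finset.mk_mem_product
        (Finset.mem_Ico.2 ⟨hpos, h.isLevel.lt_cliqueNum (Finset.mem_range.1 hi)⟩) (h.offset_mem i))
  have hcard := (Finset.card_le_card hsub).trans (Finset.card_insert_le _ _)
  have : ({1, 2, 3} : Finset ℕ).card = 3 := rfl
  rw [Finset.card_product, Nat.card_Ico, this] at hcard
  omega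

end IsKTSLS

end KTSLS

/-! ### Sizes and costs of queries -/

section Queries

variable {α : Type} [LinearOrder α] {I : ℕ → NonemptyInterval α} {N i k : ℕ} {J : List ℕ}
  {x y : α} {pts : List α} {t : ITree α}

theorem countP_le_card {β : Type*} {l : List β} (hl : l.Nodup) {p : β → Bool} {S : Finset β}
    (hS : ∀ b ∈ l, p b → b ∈ S) : l.countP p ≤ S.card := by
  classical
  rw [List.countP_eq_length_filter, ← List.toFinset_card_of_nodup (hl.filter p)]
  exact Finset.card_le_card fun b hb => by
    simp only [List.mem_toFinset, List.mem_filter] at hb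
    exact hS b hb.1 hb.2

/-- The entry of an interval tree that stands for the `i`-th interval. -/
def entry (I : ℕ → NonemptyInterval α) (i : ℕ) : ITree.Entry α := ⟨(I i).fst, (I i).snd, i⟩

theorem countP_overlaps_map_entry_le (hi : i < N) (hJ : J.Sublist (List.range N))
    (hx : (I i).fst ≤ x) (hy : y ≤ (I i).snd) :
    (J.map (entry I)).countP (ITree.Entry.Overlaps x y ·) ≤ maxDeg I N + 1 := by
  classical
  rw [List.countP_map]
  refine (countP_le_card (hJ.nodup List.nodup_range) fun j hj hover => ?_).trans
    (card_filter_meets_le_maxDeg_add_one I hi)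
  have hover := of_decide_eq_true hover
  exact Finset.mem_filter.2 ⟨Finset.mem_range.2 (List.mem_range.1 (hJ.subset hj)),
    meets_iff.2 ⟨hover.1.trans hy, hx.trans hover.2⟩⟩

/-- Let `f` be the leftmost interval that meets `[x, y]`. An interval that is near `[x, y]` does not
begin before `f`, so it meets `f`, or it begins behind `f`, hence in `[x, y]`. -/
theorem countP_near_map_entry_le (hi : i < N) (hJ : J.Sublist (List.range N))
    (hx : (I i).fst ≤ x) (hy : y ≤ (I i).snd) :
    (J.map (entry I)).countP (ITree.Near x y (J.map (entry I)) ·) ≤ 2 * (maxDeg I N + 1) := by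
  classical
  have hJ_lt : ∀ j ∈ J, j < N := fun j hj => List.mem_range.1 (hJ.subset hj)
  have near_iff (j : ℕ) : ITree.Near x y (J.map (entry I)) (entry I j) ↔
      (I j).fst ≤ y ∧ ∃ f ∈ J, x ≤ (I f).snd ∧ (I f).fst ≤ (I j).fst := by
    simp [ITree.Near, entry]
  simp only [List.countP_map, Function.comp_def, near_iff]
  rcases (J.toFinset.filter fun f => (I f).fst ≤ y ∧ x ≤ (I f).snd).eq_empty_or_nonempty
    with hempty | hne
  · refine (List.countP_eq_zero.2 fun j _ hj => ?_).trans_le (Nat.zero_le _)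
    obtain ⟨hjy, f, hf, hxf, hfj⟩ := of_decide_eq_true hj
    exact Finset.filter_eq_empty_iff.1 hempty (List.mem_toFinset.2 hf) ⟨hfj.trans hjy, hxf⟩
  obtain ⟨f, hf, hmin⟩ := Finset.exists_min_image _ (fun f => (I f).fst) hne
  simp only [Finset.mem_filter, List.mem_toFinset] at hf hmin
  set meeting : ℕ → Finset ℕ := fun k => (Finset.range N).filter fun j => Meets (I j) (I k)
  calc _ ≤ (meeting f ∪ meeting i).card := by
        refine countP_le_card (hJ.nodup List.nodup_range) fun j hj hnear => ?_
        obtain ⟨hjy, g, hg, hxg, hgj⟩ := of_decide_eq_true hnear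
        have hfj : (I f).fst ≤ (I j).fst := (hmin g ⟨hg, hgj.trans hjy, hxg⟩).trans hgj
        simp only [meeting, Finset.mem_union, Finset.mem_filter, Finset.mem_range, hJ_lt j hj,
          true_and, meets_iff]
        by_cases hjf : (I j).fst ≤ (I f).snd
        · exact .inl ⟨hjf, hfj.trans (I j).fst_le_snd⟩
        · exact .inr ⟨hjy.trans hy, hx.trans <| hf.2.2.trans <|
            (not_le.1 hjf).le.trans (I j).fst_le_snd⟩
    _ ≤ (meeting f).card + (meeting i).card := Finset.card_union_le _ _
    _ ≤ (maxDeg I N + 1) + (maxDeg I N + 1) :=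
        Nat.add_le_add (card_filter_meets_le_maxDeg_add_one I (hJ_lt f hf.1))
          (card_filter_meets_le_maxDeg_add_one I hi)
    _ = 2 * (maxDeg I N + 1) := (two_mul _).symm

/-- The list `pts` consists of distinct endpoints of the first `n` intervals. -/
structure IsEndpoints (I : ℕ → NonemptyInterval α) (n : ℕ) (pts : List α) : Prop where
  nodup : pts.Nodup
  mem : ∀ t ∈ pts, ∃ i < n, t = (I i).fst ∨ t = (I i).snd

namespace IsEndpoints

theorem mono (h : IsEndpoints I k pts) (hk : k ≤ N) : IsEndpoints I N pts :=
  ⟨h.nodup, fun t ht => (h.mem t ht).imp fun _ hi => ⟨hi.1.trans_le hk, hi.2⟩⟩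

theorem concat (h : IsEndpoints I N pts) (hi : i < N) {t : α} (ht : t = (I i).fst ∨ t = (I i).snd)
    (hnew : t ∉ pts) : IsEndpoints I N (pts ++ [t]) where
  nodup := by simpa [List.nodup_append] using ⟨h.nodup, fun s hs e => hnew (e ▸ hs)⟩
  mem s hs := by
    rcases List.mem_append.1 hs with hs | hs
    · exact h.mem s hs
    · exact ⟨i, hi, List.mem_singleton.1 hs ▸ ht⟩

theorem countP_le (h : IsEndpoints I N pts) {p : α → Bool} {S : Finset ℕ}
    (hS : ∀ i < N, p (I i).fst ∨ p (I i).snd → i ∈ S) : pts.countP p ≤ 2 * S.card := by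
  classical
  calc pts.countP p ≤ (S.image (fun i => (I i).fst) ∪ S.image (fun i => (I i).snd)).card := by
        refine countP_le_card h.nodup fun t ht hp => ?_
        rw [Finset.mem_union, Finset.mem_image, Finset.mem_image]
        obtain ⟨i, hi, rfl | rfl⟩ := h.mem t ht
        · exact .inl ⟨i, hS i hi (.inl hp), rfl⟩
        · exact .inr ⟨i, hS i hi (.inr hp), rfl⟩
    _ ≤ 2 * S.card := by
        have := Finset.card_union_le (S.image (fun i => (I i).fst)) (S.image (fun i => (I i).snd))
        have := Finset.card_image_le (s := S) (f := fun i => (I i).fst)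
        have := Finset.card_image_le (s := S) (f := fun i => (I i).snd)
        omega

theorem length_le (h : IsEndpoints I N pts) : pts.length ≤ 2 * N := by
  simpa using h.countP_le (p := fun _ => true) (S := Finset.range N) (by simp)

end IsEndpoints

/-- The entries of an interval tree that stand for the points of the list `pts`. -/
def pointEntries (pts : List α) : List (ITree.Entry α) :=
  pts.zipIdx.map fun p => ⟨p.1, p.1, p.2⟩

theorem length_pointEntries {β : Type} (pts : List β) : (pointEntries pts).length = pts.length := by
  simp [pointEntries]

theorem pointEntries_concat {β : Type} (pts : List β) (t : β) :
    pointEntries (pts ++ [t]) = pointEntries pts ++ [⟨t, t, pts.length⟩] := by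
  simp [pointEntries, List.zipIdx_append]

theorem countP_overlaps_pointEntries_le (h : IsEndpoints I N pts) (hi : i < N)
    (hx : (I i).fst ≤ x) (hy : y ≤ (I i).snd) :
    (pointEntries pts).countP (ITree.Entry.Overlaps x y ·) ≤ 2 * (maxDeg I N + 1) := by
  classical
  have hcount : (pointEntries pts).countP (ITree.Entry.Overlaps x y ·) =
      pts.countP fun t => t ≤ y ∧ x ≤ t := by
    conv_rhs => rw [← List.zipIdx_map_fst 0 pts]
    rw [pointEntries, List.countP_map, List.countP_map]
    rfl
  rw [hcount]
  refine (h.countP_le (S := (Finset.range N).filter fun j => Meets (I j) (I i))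
    fun j hj hp => ?_).trans (Nat.mul_le_mul_left 2 (card_filter_meets_le_maxDeg_add_one I hi))
  simp only [decide_eq_true_eq] at hp
  refine Finset.mem_filter.2 ⟨Finset.mem_range.2 hj, meets_iff.2 ?_⟩
  have := (I j).fst_le_snd
  rcases hp with ⟨hle, hge⟩ | ⟨hle, hge⟩
  · exact ⟨hle.trans hy, hx.trans (hge.trans this)⟩
  · exact ⟨this.trans (hle.trans hy), hx.trans hge⟩

theorem countP_near_pointEntries_le (pts : List α) (x y : α) :
    (pointEntries pts).countP (ITree.Near x y (pointEntries pts) ·) ≤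
      (pointEntries pts).countP (ITree.Entry.Overlaps x y ·) := by
  refine List.countP_mono_left fun e he hnear => decide_eq_true ?_
  obtain ⟨hey, f, hf, hxf, hfe⟩ := of_decide_eq_true hnear
  obtain ⟨_, _, rfl⟩ := List.mem_map.1 he
  obtain ⟨_, _, rfl⟩ := List.mem_map.1 hf
  exact ⟨hey, hxf.trans hfe⟩

namespace ITree.Holds

theorem mem_intersection_entry (h : t.Holds (J.map (entry I))) :
    k ∈ (t.intersection x y).val ↔ k ∈ J ∧ (I k).fst ≤ y ∧ x ≤ (I k).snd := by
  rw [h.mem_intersection]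
  simp [Entry.Overlaps, entry, ← and_assoc]

theorem length_intersection_entry_le (h : t.Holds (J.map (entry I)))
    (hJ : J.Sublist (List.range N)) (hi : i < N) (hx : (I i).fst ≤ x) (hy : y ≤ (I i).snd) :
    (t.intersection x y).val.length ≤ maxDeg I N + 1 :=
  h.length_intersection.trans_le (countP_overlaps_map_entry_le hi hJ hx hy)

theorem mem_intersection_pointEntries (h : t.Holds (pointEntries pts)) :
    k ∈ (t.intersection x y).val ↔ ∃ s, pts[k]? = some s ∧ x ≤ s ∧ s ≤ y := by
  rw [h.mem_intersection]
  simp [Entry.Overlaps, pointEntries, List.mem_zipIdx_iff_getElem?, and_comm]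

theorem length_intersection_pointEntries_le (h : t.Holds (pointEntries pts))
    (hpts : IsEndpoints I N pts) (hi : i < N) (hx : (I i).fst ≤ x) (hy : y ≤ (I i).snd) :
    (t.intersection x y).val.length ≤ 2 * (maxDeg I N + 1) :=
  h.length_intersection.trans_le (countP_overlaps_pointEntries_le hpts hi hx hy)

end ITree.Holds

/-- A bound for the heights of the interval trees during the first `N` insertions. -/
def heightBound (N : ℕ) : ℕ := 2 * Nat.log 2 (2 * N + 1) + 1

namespace ITree.Holds

variable {es : List (Entry α)}

theorem ht_le_heightBound (h : t.Holds es) (hes : es.length ≤ 2 * N) : t.ht ≤ heightBound N :=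
  h.ht_le hes

theorem time_insert_le (h : t.Holds es) (hes : es.length ≤ 2 * N) :
    (ITree.insert x y k t).time ≤ 29 * heightBound N + 7 :=
  h.balanced.time_insert_le.trans (by have := h.ht_le_heightBound hes; omega)

theorem time_intersection_entry_le (h : t.Holds (J.map (entry I)))
    (hJ : J.Sublist (List.range N)) (hi : i < N) (hx : (I i).fst ≤ x) (hy : y ≤ (I i).snd) :
    (t.intersection x y).time ≤ 1 + 9 * heightBound N + 10 * (maxDeg I N + 1) := by
  have hlen : (J.map (entry I)).length ≤ 2 * N := by
    have := hJ.length_le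
    rw [List.length_range] at this
    rw [List.length_map]
    omega
  have := h.time_intersection_le (x := x) (y := y)
  have := h.ht_le_heightBound hlen
  have := countP_near_map_entry_le hi hJ hx hy
  omega

theorem time_intersection_pointEntries_le (h : t.Holds (pointEntries pts))
    (hpts : IsEndpoints I N pts) (hi : i < N) (hx : (I i).fst ≤ x) (hy : y ≤ (I i).snd) :
    (t.intersection x y).time ≤ 1 + 9 * heightBound N + 10 * (maxDeg I N + 1) := by
  have := h.time_intersection_le (x := x) (y := y)
  have := h.ht_le_heightBound ((length_pointEntries pts).trans_le hpts.length_le)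
  have := countP_near_pointEntries_le pts x y
  have := countP_overlaps_pointEntries_le hpts hi hx hy
  omega

end ITree.Holds

end Queries

/-! ### The loops of an insertion -/

section Lists

variable {β : Type*}

theorem foldl_max_le_iff [LinearOrder β] {ls : List β} {a b : β} :
    ls.foldl max a ≤ b ↔ a ≤ b ∧ ∀ x ∈ ls, x ≤ b := by
  induction ls generalizing a with
  | nil => simp
  | cons x ls ih => simp [ih, and_assoc]

theorem sum_set_add [AddCommMonoid β] {l : List β} {k : ℕ} {a : β} (hk : l[k]? = some a) (b : β) :
    (l.set k b).sum + a = l.sum + b := by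
  induction l generalizing k with
  | nil => simp at hk
  | cons x l ih =>
    rcases k with _ | k
    · obtain rfl : x = a := by simpa using hk
      rw [List.set_cons_zero, List.sum_cons, List.sum_cons]
      abel
    · rw [List.set_cons_succ, List.sum_cons, List.sum_cons, add_assoc, add_assoc,
        ih (by simpa using hk)]

end Lists

namespace SLS

/-- The supporting line segment `e` after an interval of level `l` has been recorded in it. -/
def record (l : ℕ) (e : SLS) : SLS := ((growBy (l + 1 - e.A.elems.size) e).val.mark l).val

theorem size_A_record (l : ℕ) (e : SLS) :
    (e.record l).A.elems.size = max e.A.elems.size (l + 1) := by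
  rw [record, size_A_mark, size_A_growBy]
  omega

theorem marked_record (l : ℕ) (e : SLS) (j : ℕ) : (e.record l).Marked j ↔ e.Marked j ∨ j = l := by
  rw [record, marked_mark (by rw [size_A_growBy]; omega), marked_growBy]

theorem Valid.record {e : SLS} (h : e.Valid) (l : ℕ) : (e.record l).Valid :=
  (h.growBy _).mark l

end SLS

namespace State

/-- The level that `colors` stores for the interval with index `j`. -/
def levelAt (colors : DynArray ColorRec) (j : ℕ) : Option ℕ := colors.elems[j]?.bind (·.level)

/-- The offset that `colors` stores for the interval with index `j`. -/
def offsetAt (colors : DynArray ColorRec) (j : ℕ) : Option ℕ := colors.elems[j]?.bind (·.offset)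

/-- The height of the supporting line segment with index `k`. -/
def heightAt (sls : DynArray SLS) (k : ℕ) : Option ℕ := sls.elems[k]?.map (·.height.val)

section Loops

variable (colors : DynArray ColorRec) (sls : DynArray SLS)

theorem val_collectLevels (is : List ℕ) (h : ℕ) (U : List ℕ) :
    (collectLevels colors is h U).val =
      ((is.filterMap (levelAt colors)).foldl max h,
        (is.filterMap (levelAt colors)).reverse ++ U) := by
  induction is generalizing h U with
  | nil => rfl
  | cons i is ih =>
    simp only [collectLevels, Timed.val_bind, DynArray.val_get]
    split
    case h_1 l o hi =>
      have hl : levelAt colors i = some l := by simp [levelAt, hi]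
      simp [ih, hl]
    case h_2 hi =>
      have hl : levelAt colors i = none := by
        rcases hc : colors.elems[i]? with _ | ⟨_ | l, o⟩
        · simp [levelAt, hc]
        · simp [levelAt, hc]
        · exact absurd hc (hi l o)
      simp [ih, hl]

theorem time_collectLevels_le (is : List ℕ) (h : ℕ) (U : List ℕ) :
    (collectLevels colors is h U).time ≤ 3 * is.length + 1 := by
  induction is generalizing h U with
  | nil => simp [collectLevels]
  | cons i is ih =>
    simp only [collectLevels, Timed.time_bind, DynArray.time_get, DynArray.val_get,
      List.length_cons]
    split
    case h_1 l o _ =>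
      have := ih (max h l) (l :: U)
      simp only [Timed.time_bind, Timed.time_op, Timed.val_op]
      omega
    case h_2 =>
      have := ih h U
      omega

theorem val_usedOffsets (is : List ℕ) (u₁ u₂ : Bool) :
    (usedOffsets colors is u₁ u₂).val =
      (u₁ || (is.filterMap (offsetAt colors)).contains 1,
        u₂ || (is.filterMap (offsetAt colors)).contains 2) := by
  induction is generalizing u₁ u₂ with
  | nil => simp [usedOffsets]
  | cons i is ih =>
    simp only [usedOffsets, Timed.val_bind, DynArray.val_get]
    split
    case h_1 l o hi =>
      have ho : offsetAt colors i = some o := by simp [offsetAt, hi]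
      simp [ih, ho, Bool.or_assoc, Bool.beq_eq_decide_eq, eq_comm (a := o)]
    case h_2 hi =>
      have ho : offsetAt colors i = none := by
        rcases hc : colors.elems[i]? with _ | ⟨l, _ | o⟩
        · simp [offsetAt, hc]
        · simp [offsetAt, hc]
        · exact absurd hc (hi l o)
      simp [ih, ho]

theorem time_usedOffsets_le (is : List ℕ) (u₁ u₂ : Bool) :
    (usedOffsets colors is u₁ u₂).time ≤ 3 * is.length + 1 := by
  induction is generalizing u₁ u₂ with
  | nil => simp [usedOffsets]
  | cons i is ih =>
    simp only [usedOffsets, Timed.time_bind, DynArray.time_get, DynArray.val_get, List.length_cons]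
    split
    case h_1 l o _ =>
      have := ih (u₁ || o == 1) (u₂ || o == 2)
      simp only [Timed.time_bind, Timed.time_op, Timed.val_op]
      omega
    case h_2 =>
      have := ih u₁ u₂
      omega

theorem val_maxHeight (ks : List ℕ) (h : ℕ) :
    (maxHeight sls ks h).val = (ks.filterMap (heightAt sls)).foldl max h := by
  induction ks generalizing h with
  | nil => rfl
  | cons k ks ih =>
    simp only [maxHeight, Timed.val_bind, DynArray.val_get]
    split
    case h_1 e hk => simp [ih, heightAt, hk]
    case h_2 hk => simp [ih, heightAt, hk]

theorem time_maxHeight_le (ks : List ℕ) (h : ℕ) :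
    (maxHeight sls ks h).time ≤ 4 * ks.length + 1 := by
  induction ks generalizing h with
  | nil => simp [maxHeight]
  | cons k ks ih =>
    simp only [maxHeight, Timed.time_bind, DynArray.time_get, DynArray.val_get, List.length_cons]
    split
    case h_1 e _ =>
      have := e.time_height_le
      have := ih (max h e.height.val)
      simp only [Timed.time_bind, Timed.time_op, Timed.val_op]
      omega
    case h_2 =>
      have := ih h
      omega

end Loops

section GrowTable

variable {α : Type}

theorem elems_growTable (T : DynArray (ITree α)) (k : ℕ) :
    (growTable k T).val.elems = T.elems ++ Array.replicate k .leaf := by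
  induction k generalizing T with
  | zero => simp [growTable]
  | succ k ih =>
    simp only [growTable, Timed.val_bind, ih, DynArray.elems_push]
    apply Array.toList_inj.1
    simp [List.replicate_succ]

theorem wf_growTable {T : DynArray (ITree α)} (h : T.WF) (k : ℕ) : (growTable k T).val.WF := by
  induction k generalizing T with
  | zero => exact h
  | succ _ ih => exact ih (h.push .leaf)

theorem time_growTable_add_le {T : DynArray (ITree α)} (h : T.WF) (k : ℕ) :
    (growTable k T).time + 3 * T.cap ≤ 3 * (growTable k T).val.cap + 3 * k + 1 := by
  induction k generalizing T with
  | zero => simp [growTable, add_comm]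
  | succ k ih =>
    have := h.time_push_add_le .leaf
    have := ih (h.push .leaf)
    simp only [growTable, Timed.val_bind, Timed.time_bind]
    omega

end GrowTable

section UpdateEndpoints

variable (l : ℕ) (ks : List ℕ)

/-- The sum of the potentials of the supporting line segments in `sls`. -/
def slsPot (sls : DynArray SLS) : ℕ := (sls.elems.toList.map SLS.pot).sum

theorem slsPot_set_add {sls : DynArray SLS} {k : ℕ} {e : SLS} (hk : sls.elems[k]? = some e)
    (e' : SLS) : slsPot (sls.set k e').val + e.pot = slsPot sls + e'.pot := by
  simp only [slsPot, DynArray.elems_set, Array.toList_setIfInBounds, List.map_set]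
  exact sum_set_add (by simp [hk]) _

theorem updateEndpoints_cons_val (k : ℕ) (sls : DynArray SLS) :
    (updateEndpoints l (k :: ks) sls).val = (updateEndpoints l ks
      ((sls.elems[k]?.map fun e => (sls.set k (e.record l)).val).getD sls)).val := by
  simp only [updateEndpoints, Timed.val_bind, DynArray.val_get]
  split
  case h_1 e hk =>
    rw [hk]
    rfl
  case h_2 hk =>
    rw [hk]
    rfl

@[simp] theorem size_updateEndpoints (sls : DynArray SLS) :
    (updateEndpoints l ks sls).val.elems.size = sls.elems.size := by
  induction ks generalizing sls with
  | nil => rfl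
  | cons k ks ih =>
    rw [updateEndpoints_cons_val, ih]
    rcases sls.elems[k]? with _ | _ <;> simp

@[simp] theorem cap_updateEndpoints (sls : DynArray SLS) :
    (updateEndpoints l ks sls).val.cap = sls.cap := by
  induction ks generalizing sls with
  | nil => rfl
  | cons k ks ih =>
    rw [updateEndpoints_cons_val, ih]
    rcases sls.elems[k]? with _ | _ <;> simp

theorem getElem?_updateEndpoints (sls : DynArray SLS) (j : ℕ) :
    (updateEndpoints l ks sls).val.elems[j]? =
      sls.elems[j]?.map (SLS.record l)^[ks.count j] := by
  induction ks generalizing sls with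
  | nil => simp [updateEndpoints]
  | cons k ks ih =>
    rw [updateEndpoints_cons_val, ih]
    rcases hk : sls.elems[k]? with _ | e
    · by_cases hj : k = j
      · simp [← hj, hk]
      · simp [hj]
    · by_cases hj : k = j
      · subst hj
        obtain ⟨lt_size, -⟩ := Array.getElem?_eq_some_iff.1 hk
        simp [Array.getElem?_setIfInBounds_self_of_lt lt_size, hk]
      · simp [Array.getElem?_setIfInBounds_ne hj, hj]

theorem time_updateEndpoints_add_le {sls : DynArray SLS} (hsls : ∀ e ∈ sls.elems, e.Valid) :
    (updateEndpoints l ks sls).time + slsPot sls ≤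
      slsPot (updateEndpoints l ks sls).val + 16 * ks.length + 1 := by
  induction ks generalizing sls with
  | nil => simp [updateEndpoints, add_comm]
  | cons k ks ih =>
    simp only [updateEndpoints, Timed.val_bind, DynArray.val_get, Timed.time_bind,
      DynArray.time_get, List.length_cons]
    split
    case h_1 e hk =>
      have he : e.Valid := hsls e (Array.mem_of_getElem? hk)
      have growBy_le := he.time_growBy_add_pot_le (l + 1 - e.A.elems.size)
      have mark_le := (SLS.growBy (l + 1 - e.A.elems.size) e).val.time_mark_le l
      have pot_record : (e.record l).pot = _ := SLS.pot_mark _ l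
      have pot_set := slsPot_set_add hk (e.record l)
      have ih := ih (sls := (sls.set k (e.record l)).val) fun e' he' =>
        (Array.mem_or_eq_of_mem_setIfInBounds he').elim (hsls e') fun h => h ▸ he.record l
      simp only [Timed.val_bind, Timed.val_op, Timed.time_bind, Timed.time_op, DynArray.val_size,
        DynArray.time_size, DynArray.time_set]
      simp only [SLS.record] at *
      omega
    case h_2 =>
      have := ih hsls
      omega

end UpdateEndpoints

end State

/-! ### Correctness and amortized cost of an insertion -/

section Insertion

variable {α : Type} [LinearOrder α] {I : ℕ → NonemptyInterval α} {L o : ℕ → ℕ}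
  {N m n : ℕ} {s : State α} {pts : List α} {t : α} {c : ColorRec}

/-- Some interval of level `l` among the first `n` contains `t`. -/
def Covered (I : ℕ → NonemptyInterval α) (L : ℕ → ℕ) (n : ℕ) (t : α) (l : ℕ) : Prop :=
  ∃ j < n, t ∈ I j ∧ L j = l

theorem covered_succ {l : ℕ} :
    Covered I L (n + 1) t l ↔ Covered I L n t l ∨ t ∈ I n ∧ l = L n := by
  simp only [Covered, Nat.lt_succ_iff_lt_or_eq, or_and_right, exists_or, exists_eq_left,
    eq_comm (a := l)]

/-- Moving a point to the left up to the next first endpoint leaves none of the intervals that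
contain it. -/
theorem exists_mem_slsHeight_le (hpts : ∀ i ≤ n, (I i).fst ∈ pts) (ht : t ∈ I n) :
    ∃ s ∈ pts, s ∈ I n ∧ slsHeight I L n t ≤ slsHeight I L n s := by
  classical
  obtain ⟨s, hs, hmax⟩ := Finset.exists_max_image
    (pts.toFinset.filter fun s => (I n).fst ≤ s ∧ s ≤ t) id
    ⟨(I n).fst, by simpa [hpts n le_rfl] using ht.1⟩
  simp only [Finset.mem_filter, List.mem_toFinset, id] at hs hmax
  refine ⟨s, hs.1, ⟨hs.2.1, hs.2.2.trans ht.2⟩, slsHeight_le_slsHeight fun j hj htj =>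
    ⟨hj, ?_, hs.2.2.trans htj.2⟩⟩
  rcases le_total (I j).fst (I n).fst with hle | hle
  · exact hle.trans hs.2.1
  · exact hmax _ ⟨hpts j hj.le, hle, htj.1⟩

/-- The supporting line segment `e` is a valid record of the set `P` of levels, and it consists of
at most `m` cells. -/
structure SLS.Represents (e : SLS) (P : ℕ → Prop) (m : ℕ) : Prop where
  valid : e.Valid
  marked_iff : ∀ l, e.Marked l ↔ P l
  size_le : e.A.elems.size ≤ m

namespace SLS.Represents

variable {e : SLS} {P : ℕ → Prop} {l : ℕ}

theorem congr {Q : ℕ → Prop} (h : e.Represents P m) (hPQ : ∀ l, P l ↔ Q l) : e.Represents Q m :=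
  ⟨h.valid, fun l => (h.marked_iff l).trans (hPQ l), h.size_le⟩

theorem record (h : e.Represents P m) (hl : l < m) :
    (e.record l).Represents (fun j => P j ∨ j = l) m where
  valid := h.valid.record l
  marked_iff j := by rw [marked_record, h.marked_iff]
  size_le := e.size_A_record l ▸ max_le h.size_le hl

theorem iterate_record (h : e.Represents P m) (hl : l < m) (k : ℕ) :
    ((SLS.record l)^[k] e).Represents (fun j => P j ∨ k ≠ 0 ∧ j = l) m := by
  induction k with
  | zero => simpa using h
  | succ k ih =>
    rw [Function.iterate_succ_apply']
    exact (ih.record hl).congr fun j => by grind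

theorem val_height (h : e.Represents (Covered I L n t) m) :
    e.height.val = slsHeight I L n t := by
  have hset : {y | ¬ e.Marked y} = {y | ∀ j < n, t ∈ I j → L j ≠ y} :=
    Set.ext fun y => by simp [h.marked_iff, Covered]
  exact (hset ▸ h.valid.isLeast_height).unique (isLeast_slsHeight I L n t)

end SLS.Represents

/-- The points `pts` are stored as endpoints of the first `m` intervals, and their supporting line
segments record the first `n` intervals. -/
structure EndsInv (I : ℕ → NonemptyInterval α) (L : ℕ → ℕ) (N m n : ℕ) (ends : ITree α)
    (sls : DynArray SLS) (pts : List α) : Prop where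
  wf : sls.WF
  size_eq : sls.elems.size = pts.length
  isEndpoints : IsEndpoints I m pts
  holds : ends.Holds (pointEntries pts)
  represents : ∀ {k : ℕ} {e : SLS} {t : α}, sls.elems[k]? = some e → pts[k]? = some t →
    e.Represents (Covered I L n t) (maxDeg I N + 1)

namespace EndsInv

variable {ends : ITree α} {sls : DynArray SLS}

theorem init (I : ℕ → NonemptyInterval α) (L : ℕ → ℕ) (N : ℕ) :
    EndsInv I L N 0 0 .leaf .empty [] where
  wf := .empty
  size_eq := rfl
  isEndpoints := ⟨List.nodup_nil, by simp⟩
  holds := .leaf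
  represents := by simp

theorem mono (h : EndsInv I L N m n ends sls pts) {m' : ℕ} (hm : m ≤ m') :
    EndsInv I L N m' n ends sls pts :=
  ⟨h.wf, h.size_eq, h.isEndpoints.mono hm, h.holds, h.represents⟩

theorem concat (h : EndsInv I L N m n ends sls pts) {i : ℕ} (hi : i < m)
    (ht : t = (I i).fst ∨ t = (I i).snd) (hnew : t ∉ pts) {e : SLS}
    (he : e.Represents (Covered I L n t) (maxDeg I N + 1)) :
    EndsInv I L N m n (ITree.insert t t sls.elems.size ends).val (sls.push e).val
      (pts ++ [t]) where
  wf := h.wf.push e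
  size_eq := by simp [h.size_eq]
  isEndpoints := h.isEndpoints.concat hi ht hnew
  holds := h.holds.insert <| by
    rw [pointEntries_concat, h.size_eq]
    exact List.perm_append_singleton _ _
  represents {k f u} hk hu := by
    rw [DynArray.elems_push, Array.getElem?_push, h.size_eq] at hk
    rw [List.getElem?_append] at hu
    split_ifs at hk hu with hk_eq hk_lt
    · omega
    · cases hk
      simp only [hk_eq, Nat.sub_self, List.getElem?_cons_zero, Option.some.injEq] at hu
      exact hu ▸ he
    · exact h.represents hk hu
    · simp [show k - pts.length ≠ 0 by omega] at hu

theorem exists_represents (h : EndsInv I L N m n ends sls pts) {e : SLS} (he : e ∈ sls.elems) :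
    ∃ t, e.Represents (Covered I L n t) (maxDeg I N + 1) := by
  obtain ⟨k, hk, rfl⟩ := Array.mem_iff_getElem.1 he
  exact ⟨_, h.represents (Array.getElem?_eq_getElem hk)
    (List.getElem?_eq_getElem (h.size_eq ▸ hk))⟩

theorem heightAt_eq (h : EndsInv I L N m n ends sls pts) {k : ℕ} (hk : pts[k]? = some t) :
    State.heightAt sls k = some (slsHeight I L n t) := by
  have hlt : k < sls.elems.size := h.size_eq ▸ (List.getElem?_eq_some_iff.1 hk).1
  have he := Array.getElem?_eq_getElem hlt
  rw [State.heightAt, he, Option.map_some, (h.represents he hk).val_height]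

theorem val_maxHeight (h : EndsInv I L N m n ends sls pts) (hI : IsLevel I L)
    (hpts : ∀ i ≤ n, (I i).fst ∈ pts) :
    (State.maxHeight sls (ends.intersection (I n).fst (I n).snd).val 0).val = L n := by
  have mem_heights (y : ℕ) : y ∈ (ends.intersection (I n).fst (I n).snd).val.filterMap
      (State.heightAt sls) ↔ ∃ t ∈ pts, t ∈ I n ∧ slsHeight I L n t = y := by
    simp only [List.mem_filterMap, h.holds.mem_intersection_pointEntries]
    simp only [List.mem_iff_getElem? (l := pts)]
    constructor
    · rintro ⟨k, ⟨t, hk, hmem⟩, hy⟩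
      exact ⟨t, ⟨k, hk⟩, hmem, Option.some.inj ((h.heightAt_eq hk).symm.trans hy)⟩
    · rintro ⟨t, ⟨k, hk⟩, hmem, rfl⟩
      exact ⟨k, ⟨t, hk, hmem⟩, h.heightAt_eq hk⟩
  obtain ⟨⟨t, ht, hLn⟩, hmax⟩ := hI n
  rw [State.val_maxHeight]
  apply le_antisymm
  · refine foldl_max_le_iff.2 ⟨Nat.zero_le _, fun y hy => ?_⟩
    obtain ⟨s, -, hs, rfl⟩ := (mem_heights y).1 hy
    exact hmax ⟨s, hs, rfl⟩
  · obtain ⟨s, hs, hsn, hle⟩ := exists_mem_slsHeight_le (L := L) hpts ht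
    exact (hLn.trans_le hle).trans
      ((foldl_max_le_iff.1 le_rfl).2 _ ((mem_heights _).2 ⟨s, hs, hsn, rfl⟩))

theorem updateEndpoints (h : EndsInv I L N m n ends sls pts) (hLn : L n ≤ maxDeg I N) :
    EndsInv I L N m (n + 1) ends
      (State.updateEndpoints (L n) (ends.intersection (I n).fst (I n).snd).val sls).val pts where
  wf := ⟨by simpa using h.wf.size_le_cap, by simpa using h.wf.cap_le⟩
  size_eq := by simp [h.size_eq]
  isEndpoints := h.isEndpoints
  holds := h.holds
  represents {k e t} hk ht := by
    rw [State.getElem?_updateEndpoints] at hk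
    obtain ⟨e', he', rfl⟩ := Option.map_eq_some_iff.1 hk
    refine ((h.represents he' ht).iterate_record (Nat.lt_succ_of_le hLn) _).congr fun l => ?_
    rw [covered_succ, ne_eq, List.count_eq_zero, not_not,
      h.holds.mem_intersection_pointEntries]
    simp only [ht, Option.some.injEq, exists_eq_left']
    rfl

theorem slsPot_le (h : EndsInv I L N m n ends sls pts) :
    State.slsPot sls ≤ 2 * m * (24 * (maxDeg I N + 1)) := by
  have pot_le : ∀ p ∈ sls.elems.toList.map SLS.pot, p ≤ 24 * (maxDeg I N + 1) := by
    intro p hp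
    obtain ⟨e, he, rfl⟩ := List.mem_map.1 hp
    obtain ⟨_, hrep⟩ := h.exists_represents (Array.mem_def.2 he)
    exact hrep.valid.pot_le.trans (Nat.mul_le_mul_left _ hrep.size_le)
  calc State.slsPot sls ≤ sls.elems.size * (24 * (maxDeg I N + 1)) := by
        simpa [State.slsPot] using List.sum_le_card_nsmul _ _ pot_le
    _ ≤ 2 * m * (24 * (maxDeg I N + 1)) :=
        Nat.mul_le_mul_right _ (h.size_eq ▸ h.isEndpoints.length_le)

end EndsInv

/-- The indices of the intervals of level `l` among the first `n`. -/
def ofLevel (L : ℕ → ℕ) (n l : ℕ) : List ℕ := (List.range n).filter fun i => L i = l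

/-- Entry `l` of the table holds the intervals of level `l` among the first `n`. -/
structure TableInv (I : ℕ → NonemptyInterval α) (L : ℕ → ℕ) (N n : ℕ)
    (T : DynArray (ITree α)) : Prop where
  wf : T.WF
  holds : ∀ {l : ℕ} {tr : ITree α}, T.elems[l]? = some tr → tr.Holds ((ofLevel L n l).map (entry I))
  lt_size : ∀ i < n, L i < T.elems.size
  size_le : T.elems.size ≤ maxDeg I N + 1

namespace TableInv

variable {T : DynArray (ITree α)}

theorem init (I : ℕ → NonemptyInterval α) (L : ℕ → ℕ) (N : ℕ) : TableInv I L N 0 .empty where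
  wf := .empty
  holds h := by simp [DynArray.empty] at h
  lt_size := by simp
  size_le := Nat.zero_le _

theorem growTable (h : TableInv I L N n T) {k : ℕ} (hk : T.elems.size + k ≤ maxDeg I N + 1) :
    TableInv I L N n (State.growTable k T).val where
  wf := State.wf_growTable h.wf k
  holds {l tr} hl := by
    rw [State.elems_growTable, Array.getElem?_append] at hl
    split_ifs at hl with hlt
    · exact h.holds hl
    · obtain ⟨-, rfl⟩ : _ ∧ ITree.leaf = tr := by simpa [Array.getElem?_replicate] using hl
      have : ofLevel L n l = [] := List.filter_eq_nil_iff.2 fun i hi => by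
        have := h.lt_size i (List.mem_range.1 hi)
        rw [decide_eq_true_eq]
        omega
      rw [this]
      exact .leaf
  lt_size i hi := by
    have := h.lt_size i hi
    rw [State.elems_growTable, Array.size_append]
    omega
  size_le := by simpa [State.elems_growTable] using hk

theorem set_insert (h : TableInv I L N n T) {tr : ITree α} (htr : T.elems[L n]? = some tr) :
    TableInv I L N (n + 1)
      (T.set (L n) (ITree.insert (I n).fst (I n).snd n tr).val).val where
  wf := h.wf.set _ _
  holds {l tr'} hl := by
    have ofLevel_succ : ofLevel L (n + 1) l = ofLevel L n l ++ if L n = l then [n] else [] := by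
      simp [ofLevel, List.range_succ, List.filter_singleton]
    rw [ofLevel_succ]
    by_cases hLn : L n = l
    · subst hLn
      obtain ⟨lt_size, -⟩ := Array.getElem?_eq_some_iff.1 htr
      rw [DynArray.elems_set, Array.getElem?_setIfInBounds_self_of_lt lt_size] at hl
      cases hl
      refine (h.holds htr).insert ?_
      rw [if_pos rfl, List.map_append]
      exact List.perm_append_singleton _ _
    · rw [DynArray.elems_set, Array.getElem?_setIfInBounds_ne hLn] at hl
      simpa [hLn] using h.holds hl
  lt_size i hi := by
    rw [DynArray.elems_set, Array.size_setIfInBounds]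
    obtain hi | rfl := Nat.lt_succ_iff_lt_or_eq.1 hi
    · exact h.lt_size i hi
    · exact (Array.getElem?_eq_some_iff.1 htr).1
  size_le := by simpa using h.size_le

end TableInv

/-- The invariant of the state after `n` insertions. -/
structure StateInv (I : ℕ → NonemptyInterval α) (L o : ℕ → ℕ) (N n : ℕ) (s : State α)
    (pts : List α) : Prop where
  ivals : s.ivals.Holds ((List.range n).map (entry I))
  colors_wf : s.colors.WF
  size_colors : s.colors.elems.size = n
  colors : ∀ i < n, s.colors.elems[i]? = some ⟨some (L i), some (o i)⟩
  table : TableInv I L N n s.table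
  ends : EndsInv I L N n n s.ends s.sls pts
  fst_mem : ∀ i < n, (I i).fst ∈ pts

/-- The invariant of the state during the insertion of the interval with index `n`: its colour is
known as far as `c` tells, and the supporting line segments record the first `m` intervals. -/
structure InsertInv (I : ℕ → NonemptyInterval α) (L o : ℕ → ℕ) (N n m : ℕ) (c : ColorRec)
    (s : State α) (pts : List α) : Prop where
  ivals : s.ivals.Holds ((List.range (n + 1)).map (entry I))
  colors_wf : s.colors.WF
  size_colors : s.colors.elems.size = n + 1
  colors : ∀ i < n, s.colors.elems[i]? = some ⟨some (L i), some (o i)⟩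
  color : s.colors.elems[n]? = some c
  table : TableInv I L N n s.table
  ends : EndsInv I L N (n + 1) m s.ends s.sls pts

namespace State

/-- The potential of the amortized analysis of handle-Insert. The interval trees do not contribute:
their operations are cheap in the worst case. -/
def pot (s : State α) : ℕ :=
  3 * s.colors.cap + 3 * s.sls.cap + slsPot s.sls + 3 * s.table.cap

theorem slsPot_push (sls : DynArray SLS) (e : SLS) :
    slsPot (sls.push e).val = slsPot sls + e.pot := by
  simp [slsPot]

/-- The state after the interval `J` has been stored without a colour. -/
def addInterval (s : State α) (J : NonemptyInterval α) : State α :=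
  { s with
    ivals := (ITree.insert J.fst J.snd s.colors.elems.size s.ivals).val
    colors := (s.colors.push ⟨none, none⟩).val }

/-- The state after the level `l` of the interval with index `i` has been stored and recorded at the
endpoints with indices `S`. -/
def recordLevel (s : State α) (i l : ℕ) (S : List ℕ) : State α :=
  { s with
    colors := (s.colors.set i ⟨some l, none⟩).val
    sls := (updateEndpoints l S s.sls).val }

end State

namespace StateInv

theorem init (I : ℕ → NonemptyInterval α) (L o : ℕ → ℕ) (N : ℕ) :
    StateInv I L o N 0 State.init [] where
  ivals := .leaf
  colors_wf := .empty
  size_colors := rfl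
  colors := by simp
  table := .init I L N
  ends := .init I L N
  fst_mem := by simp

theorem addInterval (h : StateInv I L o N n s pts) :
    InsertInv I L o N n n ⟨none, none⟩ (s.addInterval (I n)) pts where
  ivals := h.ivals.insert <| by
    rw [h.size_colors, List.range_succ, List.map_append]
    exact List.perm_append_singleton _ _
  colors_wf := h.colors_wf.push _
  size_colors := by simp [State.addInterval, h.size_colors]
  colors i hi := by
    simp only [State.addInterval, DynArray.elems_push, Array.getElem?_push, h.size_colors, hi.ne,
      if_false, h.colors i hi]
  color := by
    simp only [State.addInterval, DynArray.elems_push, Array.getElem?_push, h.size_colors, if_true]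
  table := h.table
  ends := h.ends.mono n.le_succ

theorem time_addInterval_add_pot_le (h : StateInv I L o N n s pts) (hn : n < N) :
    (ITree.insert (I n).fst (I n).snd s.colors.elems.size s.ivals).time +
        (s.colors.push ⟨none, none⟩).time + s.pot ≤
      (s.addInterval (I n)).pot + 29 * heightBound N + 10 := by
  have insert_le := h.ivals.time_insert_le (x := (I n).fst) (y := (I n).snd)
    (k := s.colors.elems.size) (N := N) (by rw [List.length_map, List.length_range]; omega)
  have push_le := h.colors_wf.time_push_add_le ⟨none, none⟩
  simp only [State.pot, State.addInterval]
  omega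

theorem pot_le (h : StateInv I L o N n s pts) :
    s.pot ≤ 18 * n + 48 * n * (maxDeg I N + 1) + 6 * (maxDeg I N + 1) := by
  have cap_colors := h.colors_wf.cap_le
  have cap_table := h.table.wf.cap_le
  have size_table := h.table.size_le
  have cap_sls := h.ends.wf.cap_le
  have size_sls := h.ends.size_eq
  have length_pts := h.ends.isEndpoints.length_le
  have slsPot_le := h.ends.slsPot_le
  rw [h.size_colors] at cap_colors
  rw [show 2 * n * (24 * (maxDeg I N + 1)) = 48 * n * (maxDeg I N + 1) by ring] at slsPot_le
  unfold State.pot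
  omega

end StateInv

namespace InsertInv

theorem levelAt_eq_some_iff (h : InsertInv I L o N n m ⟨none, none⟩ s pts) {j l : ℕ} :
    State.levelAt s.colors j = some l ↔ j < n ∧ L j = l := by
  rw [State.levelAt]
  rcases lt_trichotomy j n with hj | rfl | hj
  · simp [h.colors j hj, hj]
  · simp [h.color]
  · have hsize := h.size_colors
    rw [Array.getElem?_eq_none (by omega)]
    simp [hj.not_gt]

theorem offsetAt_eq (h : InsertInv I L o N n m c s pts) {j : ℕ} (hj : j < n) :
    State.offsetAt s.colors j = some (o j) := by
  simp [State.offsetAt, h.colors j hj]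

theorem mem_levels_iff_covered (h : InsertInv I L o N n m ⟨none, none⟩ s pts) {l : ℕ} :
    l ∈ (s.ivals.intersection t t).val.filterMap (State.levelAt s.colors) ↔ Covered I L n t l := by
  simp only [List.mem_filterMap, h.ivals.mem_intersection_entry, h.levelAt_eq_some_iff,
    List.mem_range]
  exact ⟨fun ⟨j, ⟨_, ht⟩, hj, hl⟩ => ⟨j, hj, ht, hl⟩,
    fun ⟨j, hj, ht, hl⟩ => ⟨j, ⟨hj.trans n.lt_succ_self, ht⟩, hj, hl⟩⟩

theorem computeSLS_represents (h : InsertInv I L o N n m ⟨none, none⟩ s pts) (hL : IsLevel I L)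
    (hn : n < N) : (s.computeSLS t).val.Represents (Covered I L n t) (maxDeg I N + 1) := by
  simp only [State.computeSLS, Timed.val_bind, Timed.val_op, State.val_collectLevels,
    List.append_nil]
  set ls := (s.ivals.intersection t t).val.filterMap (State.levelAt s.colors)
  have le_maxDeg : ∀ l ∈ ls, l ≤ maxDeg I N := fun l hl => by
    obtain ⟨j, hj, -, rfl⟩ := h.mem_levels_iff_covered.1 hl
    exact hL.le_maxDeg (hj.trans hn)
  have le_max : ∀ l ∈ ls, l ≤ ls.foldl max 0 := (foldl_max_le_iff.1 le_rfl).2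
  refine ⟨(SLS.Valid.empty.growBy _).markAll _, fun l => ?_, ?_⟩
  · rw [SLS.marked_markAll, SLS.marked_growBy, List.mem_reverse, h.mem_levels_iff_covered,
      or_iff_right]
    · simp [SLS.Marked, SLS.empty, DynArray.empty]
    · intro l hl
      rw [SLS.size_A_growBy]
      have := le_max l (List.mem_reverse.1 hl)
      omega
  · simpa [SLS.empty, DynArray.empty] using foldl_max_le_iff.2 ⟨Nat.zero_le _, le_maxDeg⟩

theorem time_computeSLS_le (h : InsertInv I L o N n m c s pts) (hn : n < N) (ht : t ∈ I n) :
    (s.computeSLS t).time ≤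
      (s.computeSLS t).val.pot + 9 * heightBound N + 24 * (maxDeg I N + 1) + 5 := by
  have hJ : (List.range (n + 1)).Sublist (List.range N) := List.range_sublist.2 hn
  have query_le := h.ivals.time_intersection_entry_le hJ hn ht.1 ht.2
  have length_le := h.ivals.length_intersection_entry_le hJ hn ht.1 ht.2
  simp only [State.computeSLS, Timed.val_bind, Timed.time_bind, Timed.val_op, Timed.time_op,
    State.val_collectLevels, List.append_nil, SLS.pot_markAll]
  set js := (s.ivals.intersection t t).val
  set ls := js.filterMap (State.levelAt s.colors)
  have collect_le := State.time_collectLevels_le s.colors js 0 []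
  have growBy_le := SLS.Valid.empty.time_growBy_add_pot_le (ls.foldl max 0 + 1)
  have markAll_le := (SLS.growBy (ls.foldl max 0 + 1) SLS.empty).val.time_markAll_le ls.reverse
  have length_ls : ls.length ≤ js.length := List.length_filterMap_le _ _
  rw [List.length_reverse] at markAll_le
  omega

theorem isEmpty_intersection_iff (h : InsertInv I L o N n m c s pts) :
    (s.ends.intersection t t).val.isEmpty ↔ t ∉ pts := by
  rw [List.isEmpty_iff, List.eq_nil_iff_forall_not_mem]
  simp only [h.ends.holds.mem_intersection_pointEntries, List.mem_iff_getElem?, not_exists]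
  exact ⟨fun hk k hkt => hk k t ⟨hkt, le_rfl, le_rfl⟩,
    fun hk k u ⟨hu, htu, hut⟩ => hk k (le_antisymm htu hut ▸ hu)⟩

theorem addEndpoint (h : InsertInv I L o N n n ⟨none, none⟩ s pts) (hL : IsLevel I L) (hn : n < N)
    (ht : t = (I n).fst ∨ t = (I n).snd) :
    ∃ pts', pts ⊆ pts' ∧ t ∈ pts' ∧
      InsertInv I L o N n n ⟨none, none⟩ (s.addEndpoint t).val pts' := by
  simp only [State.addEndpoint, Timed.val_bind, Timed.val_op, Timed.val_ite,
    h.isEmpty_intersection_iff]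
  split_ifs with hmem
  · exact ⟨pts, List.Subset.refl _, hmem, h⟩
  · exact ⟨pts ++ [t], List.subset_append_left _ _, by simp, h.ivals, h.colors_wf, h.size_colors,
      h.colors, h.color, h.table,
      h.ends.concat n.lt_succ_self ht hmem (h.computeSLS_represents hL hn)⟩

theorem time_addEndpoint_add_pot_le (h : InsertInv I L o N n m c s pts) (hn : n < N)
    (ht : t ∈ I n) :
    (s.addEndpoint t).time + s.pot ≤
      (s.addEndpoint t).val.pot + 47 * heightBound N + 34 * (maxDeg I N + 1) + 19 := by
  have hends : IsEndpoints I N pts := h.ends.isEndpoints.mono hn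
  have query_le := h.ends.holds.time_intersection_pointEntries_le hends hn ht.1 ht.2
  have computeSLS_le := h.time_computeSLS_le hn ht
  have push_le := h.ends.wf.time_push_add_le (s.computeSLS t).val
  have pot_push := State.slsPot_push s.sls (s.computeSLS t).val
  have insert_le := h.ends.holds.time_insert_le (x := t) (y := t) (k := s.sls.elems.size) (N := N)
    (by rw [length_pointEntries]; exact hends.length_le)
  simp only [State.addEndpoint, Timed.val_bind, Timed.time_bind, Timed.val_op, Timed.time_op]
  cases (s.ends.intersection t t).val.isEmpty
  · simp only [Bool.false_eq_true, if_false, Timed.val_pure, Timed.time_pure]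
    omega
  · simp only [if_true, State.pot, Timed.val_bind, Timed.time_bind, Timed.val_op, Timed.time_op,
      DynArray.val_size, DynArray.time_size]
    omega

theorem val_computeMaxSLS (h : InsertInv I L o N n n c s pts) (hL : IsLevel I L)
    (hpts : ∀ i ≤ n, (I i).fst ∈ pts) :
    (s.computeMaxSLS (I n).fst (I n).snd).val =
      ((s.ends.intersection (I n).fst (I n).snd).val, L n) :=
  congrArg (Prod.mk _) (h.ends.val_maxHeight hL hpts)

theorem length_intersection_le (h : InsertInv I L o N n m c s pts) (hn : n < N) :
    (s.ends.intersection (I n).fst (I n).snd).val.length ≤ 2 * (maxDeg I N + 1) :=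
  h.ends.holds.length_intersection_pointEntries_le (h.ends.isEndpoints.mono hn) hn le_rfl le_rfl

theorem time_computeMaxSLS_le (h : InsertInv I L o N n m c s pts) (hn : n < N) :
    (s.computeMaxSLS (I n).fst (I n).snd).time ≤
      9 * heightBound N + 18 * (maxDeg I N + 1) + 3 := by
  have query_le := h.ends.holds.time_intersection_pointEntries_le
    (h.ends.isEndpoints.mono hn) hn le_rfl le_rfl
  have length_le := h.length_intersection_le hn
  have maxHeight_le :=
    State.time_maxHeight_le s.sls (s.ends.intersection (I n).fst (I n).snd).val 0
  simp only [State.computeMaxSLS, Timed.time_bind, Timed.time_op]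
  omega

theorem recordLevel (h : InsertInv I L o N n n c s pts) (hL : IsLevel I L) (hn : n < N) :
    InsertInv I L o N n (n + 1) ⟨some (L n), none⟩
      (s.recordLevel n (L n) (s.ends.intersection (I n).fst (I n).snd).val) pts where
  ivals := h.ivals
  colors_wf := h.colors_wf.set _ _
  size_colors := by simp [State.recordLevel, h.size_colors]
  colors i hi := by
    simp only [State.recordLevel, DynArray.elems_set, Array.getElem?_setIfInBounds_ne hi.ne',
      h.colors i hi]
  color := by
    simp only [State.recordLevel, DynArray.elems_set]
    exact Array.getElem?_setIfInBounds_self_of_lt (by rw [h.size_colors]; omega)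
  table := h.table
  ends := h.ends.updateEndpoints (hL.le_maxDeg hn)

theorem time_recordLevel_add_pot_le (h : InsertInv I L o N n m c s pts) (hn : n < N) (l : ℕ) :
    (State.updateEndpoints l (s.ends.intersection (I n).fst (I n).snd).val s.sls).time + s.pot ≤
      (s.recordLevel n l (s.ends.intersection (I n).fst (I n).snd).val).pot +
        32 * (maxDeg I N + 1) + 1 := by
  have length_le := h.length_intersection_le hn
  have update_le := State.time_updateEndpoints_add_le l
    (s.ends.intersection (I n).fst (I n).snd).val fun e he =>
      (h.ends.exists_represents he).elim fun _ hrep => hrep.valid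
  simp only [State.pot, State.recordLevel, DynArray.cap_set, State.cap_updateEndpoints]
  omega

end InsertInv

theorem IsKTSLS.offset_eq_ite (h : IsKTSLS I L o) (i : ℕ) {u₁ u₂ : Prop} [Decidable u₁]
    [Decidable u₂] (h₁ : u₁ ↔ ∃ j < i, Meets (I j) (I i) ∧ L j = L i ∧ o j = 1)
    (h₂ : u₂ ↔ ∃ j < i, Meets (I j) (I i) ∧ L j = L i ∧ o j = 2) :
    o i = if u₁ then if u₂ then 3 else 2 else 1 := by
  obtain ⟨⟨mem, notMem⟩, least⟩ := h.offset i
  simp only [Set.mem_insert_iff, Set.mem_singleton_iff] at mem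
  have ne_one (hu : u₁) : o i ≠ 1 := fun ho => notMem (ho ▸ h₁.1 hu)
  have ne_two (hu : u₂) : o i ≠ 2 := fun ho => notMem (ho ▸ h₂.1 hu)
  have le_one (hu : ¬ u₁) : o i ≤ 1 := least ⟨by simp, fun hc => hu (h₁.2 hc)⟩
  have le_two (hu : ¬ u₂) : o i ≤ 2 := least ⟨by simp, fun hc => hu (h₂.2 hc)⟩
  grind

namespace InsertInv

theorem ite_usedOffsets (h : InsertInv I L o N n m c s pts) (hkt : IsKTSLS I L o) {tr : ITree α}
    (htr : tr.Holds ((ofLevel L n (L n)).map (entry I))) :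
    let u := (State.usedOffsets s.colors (tr.intersection (I n).fst (I n).snd).val false false).val
    (if u.1 then (if u.2 then 3 else 2) else 1) = o n := by
  have contains_iff (a : ℕ) : ((tr.intersection (I n).fst (I n).snd).val.filterMap
      (State.offsetAt s.colors)).contains a ↔
        ∃ j < n, Meets (I j) (I n) ∧ L j = L n ∧ o j = a := by
    simp only [List.contains_iff_mem, List.mem_filterMap, htr.mem_intersection_entry, ofLevel,
      List.mem_filter, List.mem_range, decide_eq_true_eq, meets_iff]
    constructor
    · rintro ⟨j, ⟨⟨hj, hl⟩, hm⟩, ho⟩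
      exact ⟨j, hj, hm, hl, Option.some.inj ((h.offsetAt_eq hj).symm.trans ho)⟩
    · rintro ⟨j, hj, hm, hl, rfl⟩
      exact ⟨j, ⟨⟨hj, hl⟩, hm⟩, h.offsetAt_eq hj⟩
  rw [State.val_usedOffsets]
  exact (hkt.offset_eq_ite n (contains_iff 1) (contains_iff 2)).symm

theorem exists_getElem?_growTable (h : InsertInv I L o N n m c s pts) (hLn : L n ≤ maxDeg I N) :
    ∃ tr, (State.growTable (L n + 1 - s.table.elems.size) s.table).val.elems[L n]? = some tr ∧
      TableInv I L N n (State.growTable (L n + 1 - s.table.elems.size) s.table).val := by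
  have size_le := h.table.size_le
  refine ⟨_, Array.getElem?_eq_getElem ?_, h.table.growTable (by omega)⟩
  rw [State.elems_growTable, Array.size_append, Array.size_replicate]
  omega

theorem computeOffset (h : InsertInv I L o N n (n + 1) c s pts) (hkt : IsKTSLS I L o) (hn : n < N)
    (hpts : ∀ i ≤ n, (I i).fst ∈ pts) :
    StateInv I L o N (n + 1) (s.computeOffset (I n).fst (I n).snd n (L n)).val pts := by
  obtain ⟨tr, htr, hT⟩ := h.exists_getElem?_growTable (hkt.isLevel.le_maxDeg hn)
  simp only [State.computeOffset, Timed.val_bind, Timed.val_op, DynArray.val_size,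
    DynArray.val_get, htr, h.ite_usedOffsets hkt (hT.holds htr)]
  refine ⟨h.ivals, h.colors_wf.set _ _, by simp [h.size_colors], fun i hi => ?_,
    hT.set_insert htr, h.ends, fun i hi => hpts i (Nat.le_of_lt_succ hi)⟩
  obtain hi | rfl := Nat.lt_succ_iff_lt_or_eq.1 hi
  · rw [DynArray.elems_set, Array.getElem?_setIfInBounds_ne hi.ne', h.colors i hi]
  · rw [DynArray.elems_set, Array.getElem?_setIfInBounds_self_of_lt (by rw [h.size_colors]; omega)]

theorem time_computeOffset_add_pot_le (h : InsertInv I L o N n m c s pts) (hn : n < N)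
    (hLn : L n ≤ maxDeg I N) :
    (s.computeOffset (I n).fst (I n).snd n (L n)).time + s.pot ≤
      (s.computeOffset (I n).fst (I n).snd n (L n)).val.pot +
        38 * heightBound N + 16 * (maxDeg I N + 1) + 17 := by
  obtain ⟨tr, htr, hT⟩ := h.exists_getElem?_growTable hLn
  have holds := hT.holds htr
  have hJ : (ofLevel L n (L n)).Sublist (List.range N) :=
    List.filter_sublist.trans (List.range_sublist.2 hn.le)
  have growTable_le :=
    State.time_growTable_add_le h.table.wf (L n + 1 - s.table.elems.size)
  have query_le := holds.time_intersection_entry_le hJ hn le_rfl le_rfl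
  have length_le := holds.length_intersection_entry_le hJ hn le_rfl le_rfl
  have used_le := State.time_usedOffsets_le s.colors
    (tr.intersection (I n).fst (I n).snd).val false false
  have insert_le := holds.time_insert_le (x := (I n).fst) (y := (I n).snd) (k := n) (N := N) (by
    have := hJ.length_le
    rw [List.length_range] at this
    rw [List.length_map]
    omega)
  simp only [State.computeOffset, State.pot, Timed.val_bind, Timed.time_bind, Timed.val_op,
    Timed.time_op, DynArray.val_size, DynArray.time_size, DynArray.val_get, DynArray.time_get,
    DynArray.time_set, DynArray.cap_set, htr]
  omega

end InsertInv

namespace State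

/-- The state after the interval `J` and its endpoints have been stored. -/
def addWithEndpoints (s : State α) (J : NonemptyInterval α) : State α :=
  (((s.addInterval J).addEndpoint J.fst).val.addEndpoint J.snd).val

theorem val_handleInsert (s : State α) (J : NonemptyInterval α) :
    let i := s.colors.elems.size
    let s' := s.addWithEndpoints J
    let Sh := (s'.computeMaxSLS J.fst J.snd).val
    (s.handleInsert J).val =
      ((s'.recordLevel i Sh.2 Sh.1).computeOffset J.fst J.snd i Sh.2).val := by
  simp only [handleInsert, addWithEndpoints, addInterval, recordLevel, Timed.val_bind,
    Timed.val_op, DynArray.val_size]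

theorem time_handleInsert (s : State α) (J : NonemptyInterval α) :
    let i := s.colors.elems.size
    let s₁ := s.addInterval J
    let s₂ := (s₁.addEndpoint J.fst).val
    let s' := s.addWithEndpoints J
    let Sh := (s'.computeMaxSLS J.fst J.snd).val
    (s.handleInsert J).time =
      (ITree.insert J.fst J.snd i s.ivals).time + (s.colors.push ⟨none, none⟩).time +
      (s₁.addEndpoint J.fst).time + (s₂.addEndpoint J.snd).time +
      (s'.computeMaxSLS J.fst J.snd).time + (updateEndpoints Sh.2 Sh.1 s'.sls).time +
      ((s'.recordLevel i Sh.2 Sh.1).computeOffset J.fst J.snd i Sh.2).time + 4 := by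
  simp only [handleInsert, addWithEndpoints, addInterval, recordLevel, Timed.time_bind,
    Timed.val_op, Timed.time_op, DynArray.val_size, DynArray.time_size,
    DynArray.time_set]
  omega

end State

namespace StateInv

theorem addWithEndpoints (h : StateInv I L o N n s pts) (hL : IsLevel I L) (hn : n < N) :
    ∃ pts', (∀ i ≤ n, (I i).fst ∈ pts') ∧
      InsertInv I L o N n n ⟨none, none⟩ (s.addWithEndpoints (I n)) pts' := by
  obtain ⟨pts₁, hsub₁, hfst, h₁⟩ := h.addInterval.addEndpoint hL hn (.inl rfl)
  obtain ⟨pts₂, hsub₂, -, h₂⟩ := h₁.addEndpoint hL hn (.inr rfl)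
  refine ⟨pts₂, fun i hi => hsub₂ ?_, h₂⟩
  obtain hi | rfl := hi.lt_or_eq
  · exact hsub₁ (h.fst_mem i hi)
  · exact hfst

theorem time_addWithEndpoints_add_pot_le (h : StateInv I L o N n s pts) (hL : IsLevel I L)
    (hn : n < N) :
    (ITree.insert (I n).fst (I n).snd s.colors.elems.size s.ivals).time +
        (s.colors.push ⟨none, none⟩).time +
        ((s.addInterval (I n)).addEndpoint (I n).fst).time +
        (((s.addInterval (I n)).addEndpoint (I n).fst).val.addEndpoint (I n).snd).time + s.pot ≤
      (s.addWithEndpoints (I n)).pot + 123 * heightBound N + 68 * (maxDeg I N + 1) + 48 := by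
  obtain ⟨_, -, -, h₁⟩ := h.addInterval.addEndpoint hL hn (.inl rfl)
  have interval_le := h.time_addInterval_add_pot_le hn
  have fst_le := h.addInterval.time_addEndpoint_add_pot_le hn
    (⟨le_rfl, (I n).fst_le_snd⟩ : (I n).fst ∈ I n)
  have snd_le := h₁.time_addEndpoint_add_pot_le hn
    (⟨(I n).fst_le_snd, le_rfl⟩ : (I n).snd ∈ I n)
  unfold State.addWithEndpoints
  omega

theorem handleInsert (h : StateInv I L o N n s pts) (hkt : IsKTSLS I L o) (hn : n < N) :
    ∃ pts', StateInv I L o N (n + 1) (s.handleInsert (I n)).val pts' := by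
  obtain ⟨pts', hpts, h'⟩ := h.addWithEndpoints hkt.isLevel hn
  rw [State.val_handleInsert, h'.val_computeMaxSLS hkt.isLevel hpts, h.size_colors]
  exact ⟨pts', (h'.recordLevel hkt.isLevel hn).computeOffset hkt hn hpts⟩

theorem time_handleInsert_add_pot_le (h : StateInv I L o N n s pts) (hL : IsLevel I L)
    (hn : n < N) :
    (s.handleInsert (I n)).time + s.pot ≤
      (s.handleInsert (I n)).val.pot + 170 * heightBound N + 134 * (maxDeg I N + 1) + 73 := by
  obtain ⟨pts', hpts, h'⟩ := h.addWithEndpoints hL hn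
  have add_le := h.time_addWithEndpoints_add_pot_le hL hn
  have computeMaxSLS_le := h'.time_computeMaxSLS_le hn
  have recordLevel_le := h'.time_recordLevel_add_pot_le hn (L n)
  have computeOffset_le :=
    (h'.recordLevel hL hn).time_computeOffset_add_pot_le hn (hL.le_maxDeg hn)
  rw [h.size_colors] at add_le
  rw [State.time_handleInsert, State.val_handleInsert, h'.val_computeMaxSLS hL hpts, h.size_colors]
  dsimp only
  omega

end StateInv

/-! ### Sequences of insertions -/

theorem IsKTSLS.exists_stateInv_run (hkt : IsKTSLS I L o) (hn : n ≤ N) :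
    ∃ pts, StateInv I L o N n (run I n).val pts := by
  induction n with
  | zero => exact ⟨[], .init I L o N⟩
  | succ n ih =>
    obtain ⟨_, h⟩ := ih (n.le_succ.trans hn)
    exact h.handleInsert hkt hn

theorem IsKTSLS.color_run (hkt : IsKTSLS I L o) {i : ℕ} (hi : i < n) :
    (run I n).val.color i = some (L i, o i) := by
  obtain ⟨_, h⟩ := hkt.exists_stateInv_run (le_refl n)
  simp [State.color, h.colors i hi]

theorem IsKTSLS.time_run_le_pot_add (hkt : IsKTSLS I L o) (hn : n ≤ N) :
    (run I n).time ≤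
      (run I n).val.pot + n * (170 * heightBound N + 134 * (maxDeg I N + 1) + 73) := by
  induction n with
  | zero => simp [run]
  | succ n ih =>
    obtain ⟨_, h⟩ := hkt.exists_stateInv_run (n.le_succ.trans hn)
    have run_le := ih (n.le_succ.trans hn)
    have insert_le := h.time_handleInsert_add_pot_le hkt.isLevel hn
    rw [Nat.succ_mul]
    simp only [run, Timed.val_bind, Timed.time_bind]
    omega

theorem time_run_le (I : ℕ → NonemptyInterval α) (hn : 1 ≤ n) :
    (run I n).time ≤ n * (340 * Nat.log 2 (2 * n + 1) + 450 * (maxDeg I n + 1)) := by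
  have hkt := isKTSLS_ktLevel_ktOffset I
  obtain ⟨_, h⟩ := hkt.exists_stateInv_run (le_refl n)
  have run_le := hkt.time_run_le_pot_add (le_refl n)
  have pot_le := h.pot_le
  have mul_le := Nat.mul_le_mul_right (maxDeg I n + 1) hn
  unfold heightBound at run_le
  nlinarith

theorem log_two_mul_add_one_le (hn : 2 ≤ n) : (Nat.log 2 (2 * n + 1) : ℝ) ≤ 5 * Real.log n := by
  have two_le : (2 : ℝ) ≤ n := by exact_mod_cast hn
  have half_lt_log_two : (1 : ℝ) / 2 < Real.log 2 := by linarith [Real.log_two_gt_d9]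
  have sq_le : (2 * n + 1 : ℝ) ^ 2 ≤ n ^ 5 := by
    have : (2 : ℝ) ^ 3 ≤ n ^ 3 := by gcongr
    nlinarith [sq_nonneg (n : ℝ)]
  have pow_log_le : (2 : ℝ) ^ Nat.log 2 (2 * n + 1) ≤ 2 * n + 1 := by
    exact_mod_cast Nat.pow_log_le_self 2 (by omega)
  have log_sq_le := Real.log_le_log (by positivity) sq_le
  have log_pow_le := Real.log_le_log (by positivity) pow_log_le
  rw [Real.log_pow, Real.log_pow] at log_sq_le
  rw [Real.log_pow] at log_pow_le
  push_cast at log_sq_le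
  nlinarith [Nat.cast_nonneg (α := ℝ) (Nat.log 2 (2 * n + 1))]

theorem time_run_le_log (I : ℕ → NonemptyInterval α) (hn : 2 ≤ n) :
    ((run I n).time : ℝ) ≤ n * (3000 * (Real.log n + maxDeg I n)) := by
  have half_le_log : (1 : ℝ) / 2 ≤ Real.log n := by
    have : Real.log 2 ≤ Real.log n := Real.log_le_log two_pos (by exact_mod_cast hn)
    linarith [Real.log_two_gt_d9]
  calc ((run I n).time : ℝ)
      ≤ n * (340 * Nat.log 2 (2 * n + 1) + 450 * (maxDeg I n + 1)) := by
        exact_mod_cast time_run_le I (by omega)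
    _ ≤ n * (3000 * (Real.log n + maxDeg I n)) := by
        gcongr
        have := log_two_mul_add_one_le hn
        have : (0 : ℝ) ≤ maxDeg I n := Nat.cast_nonneg _
        linarith

theorem color_run_ne_of_adj {i j : Fin n} (hij : (intervalGraph I n).Adj i j) :
    (run I n).val.color i ≠ (run I n).val.color j := by
  have hkt := isKTSLS_ktLevel_ktOffset I
  rw [hkt.color_run i.2, hkt.color_run j.2, Ne, Option.some.injEq]
  exact hkt.color_ne_of_meets (Fin.val_ne_of_ne hij.1) hij.2

theorem card_image_color_run_add_two_le (I : ℕ → NonemptyInterval α) (hn : 1 ≤ n) :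
    ((Finset.range n).image fun i => (run I n).val.color i).card + 2 ≤
      3 * (intervalGraph I n).cliqueNum := by
  have hkt := isKTSLS_ktLevel_ktOffset I
  have image_eq : ((Finset.range n).image fun i => (run I n).val.color i) =
      ((Finset.range n).image fun i => (ktLevel I i, ktOffset I (ktLevel I) i)).image some := by
    rw [Finset.image_image]
    exact Finset.image_congr fun i hi => hkt.color_run (by simpa using hi)
  rw [image_eq]
  exact (Nat.add_le_add_right Finset.card_image_le 2).trans (hkt.card_colors_add_two_le hn)

end Insertion

end IntervalColoring

theorem mainTheorem1_general :
    ∃ C : ℝ, 0 < C ∧ ∀ (α : Type) [LinearOrder α] (I : ℕ → NonemptyInterval α),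
      (∀ n : ℕ, 2 ≤ n →
        ((IntervalColoring.run I n).time : ℝ) ≤
          n * (C * (Real.log n + IntervalColoring.maxDeg I n))) ∧
      (∃ L o : ℕ → ℕ, IntervalColoring.IsKTSLS I L o ∧
        ∀ n : ℕ, ∀ i < n, (IntervalColoring.run I n).val.color i = some (L i, o i)) ∧
      (∀ n : ℕ, ∀ i j : Fin n, (IntervalColoring.intervalGraph I n).Adj i j →
        (IntervalColoring.run I n).val.color i ≠ (IntervalColoring.run I n).val.color j) ∧
      (∀ n : ℕ, 1 ≤ n →
        ((Finset.range n).image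
          fun i => (IntervalColoring.run I n).val.color i).card + 2 ≤
            3 * (IntervalColoring.intervalGraph I n).cliqueNum) := by
  open IntervalColoring in
  exact ⟨3000, by norm_num, fun α _ I =>
    ⟨fun _ hn => time_run_le_log I hn,
      ⟨_, _, isKTSLS_ktLevel_ktOffset I, fun _ _ hi => (isKTSLS_ktLevel_ktOffset I).color_run hi⟩,
      fun _ _ _ hij => color_run_ne_of_adj hij,
      fun _ hn => card_image_color_run_add_two_le I hn⟩⟩

theorem mainTheorem1 :
    ∃ C : ℝ, 0 < C ∧ ∀ I : ℕ → NonemptyInterval ℝ,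
      -- total time of `n` insertions, that is, `n` times the amortized time per insertion
      (∀ n : ℕ, 2 ≤ n →
        ((IntervalColoring.run I n).time : ℝ) ≤
          n * (C * (Real.log n + IntervalColoring.maxDeg I n))) ∧
      -- the stored colours are those of KT-SLS, after every insertion
      (∃ L o : ℕ → ℕ, IntervalColoring.IsKTSLS I L o ∧
        ∀ n : ℕ, ∀ i < n, (IntervalColoring.run I n).val.color i = some (L i, o i)) ∧
      -- after every insertion the colouring is proper and uses at most `3ω - 2` colours
      (∀ n : ℕ, ∀ i j : Fin n, (IntervalColoring.intervalGraph I n).Adj i j →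
        (IntervalColoring.run I n).val.color i ≠ (IntervalColoring.run I n).val.color j) ∧
      (∀ n : ℕ, 1 ≤ n →
        ((Finset.range n).image
          fun i => (IntervalColoring.run I n).val.color i).card + 2 ≤
            3 * (IntervalColoring.intervalGraph I n).cliqueNum) := by
  obtain ⟨C, hC, h⟩ := mainTheorem1_general
  exact ⟨C, hC, h ℝ⟩
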